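/- Let $V:(0,\infty)\to\mathbb R$ be a potential that is square-integrable on every $[a,b]\subset(0,\infty)$, and suppose that the spherically symmetric operator $D=-\nabla^2+V(|\mathbf r|)$ is bounded below on $C_c^\infty(\mathbb R^3\setminus\{0\})$. Consider $D$ in $L^2(\mathbb R^3)$, and for $l=0,1,2,\dots$ the radial operator $$D_l=-\frac1{r^2}\frac{d}{dr}\Big(r^2\frac{d}{dr}\Big)+\frac{l(l+1)}{r^2}+V(r)$$ in $L^2((0,\infty),r^2dr)$, both realized as self-adjoint operators by the Friedrichs extension from the smooth functions compactly supported in $\mathbb R^3\setminus\{0\}$, respectively in $(0,\infty)$. The heat kernel of such an operator $A$ in $L^2(\mu)$, on the open set $\Omega$ in question, is a kernel $K(t;x,y)$, continuous in $(x,y)\in\Omega\times\Omega$ for each $t>0$, that is the Green function of the initial-value problem of $(\partial_t+A)u=0$: for every $f\in C_c^\infty(\Omega)$ the function $u(t)=\int K(t;\cdot,y)f(y)\,d\mu(y)$ lies in the domain of $A$ and satisfies $\partial_tu=-Au$ in $L^2(\mu)$ for $t>0$, and $u(t)\to f$ in $L^2(\mu)$ as $t\to0^+$. Let $K$ be the heat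 kernel of $D$ (with $d\mu=d\mathbf r$) and, for every $l$, let $K_l$ be the heat kernel of $D_l$ (with $d\mu=r^2dr$), the partial-wave heat kernel. Let $P_l$ be the Legendre polynomials. For points with spherical coordinates $(r,\theta,\varphi)$ and $(r',\theta',\varphi')$, $r,r'>0$, let $\cos\gamma=\cos\theta\cos\theta'+\sin\theta\sin\theta'\cos(\varphi'-\varphi)$. Then, for all $t,r,r'>0$, the value $K(t;r,\theta,\varphi,r',\theta',\varphi')$ depends on the angles only through $\cos\gamma\in[-1,1]$, and for every $l$ $$K_l(t;r,r')=2\pi\int_{-1}^{1}d\cos\gamma\;P_l(\cos\gamma)\,K(t;r,\theta,\varphi,r',\theta',\varphi').$$ Conversely, for all angles, $$K(t;r,\theta,\varphi,r',\theta',\varphi')=\frac1{4\pi}\sum_{l=0}^\infty(2l+1)P_l(\cos\gamma)K_l(t;r,r'),$$ where the series converges absolutely. -/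

import Mathlib

open MeasureTheory Set Filter Topology TopologicalSpace Polynomial
open scoped ContDiff Distributions InnerProductSpace ENNReal

noncomputable section

namespace PartialWave

/-- Euclidean three-space. -/
abbrev E3 : Type := EuclideanSpace ℝ (Fin 3)

/-- The Legendre polynomial `P_l` (Rodrigues' formula), normalized by `P_l(1) = 1`. -/
def legendre (l : ℕ) : ℝ[X] :=
  C (1 / (2 ^ l * (l.factorial : ℝ))) * derivative^[l] ((X ^ 2 - 1) ^ l)

/-- The point of `ℝ³` with spherical coordinates `(r, θ, φ)`. -/
def sph (r θ φ : ℝ) : E3 :=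
  !₂[r * (Real.sin θ * Real.cos φ), r * (Real.sin θ * Real.sin φ), r * Real.cos θ]

/-- `cos γ`, where `γ` is the angle between the directions `(θ, φ)` and `(θ', φ')`. -/
def cosAngle (θ φ θ' φ' : ℝ) : ℝ :=
  Real.cos θ * Real.cos θ' + Real.sin θ * Real.sin θ' * Real.cos (φ' - φ)

/-- `ℝ³ \ {0}`. -/
def punctured : Opens E3 := ⟨{0}ᶜ, isOpen_compl_singleton⟩

/-- The half-line `(0, ∞)`. -/
def halfLine : Opens ℝ := ⟨Ioi 0, isOpen_Ioi⟩

/-- The measure `r² dr` on `(0, ∞)`. -/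
def radialMeasure : Measure ℝ :=
  (volume.restrict (Ioi 0)).withDensity fun r => ENNReal.ofReal (r ^ 2)

/-- The differential expression `D = -∇² + V(|x|)` on `ℝ³`. -/
def fullOp (V : ℝ → ℝ) (ψ : E3 → ℝ) (x : E3) : ℝ :=
  -(Laplacian.laplacian ψ x) + V ‖x‖ * ψ x

/-- The radial differential expression
`D_l = -(1/r²) d/dr (r² d/dr) + l(l+1)/r² + V(r)`. -/
def radialOp (V : ℝ → ℝ) (l : ℕ) (R : ℝ → ℝ) (r : ℝ) : ℝ :=
  -(1 / r ^ 2 * deriv (fun s => s ^ 2 * deriv R s) r)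
    + (l : ℝ) * ((l : ℝ) + 1) / r ^ 2 * R r + V r * R r

section Operator

variable {E : Type*} [NormedAddCommGroup E] [NormedSpace ℝ E] [MeasurableSpace E]

/-- The graph in `L²(μ)` of the differential expression `L` with domain the smooth functions
compactly supported in `Ω`. -/
def minimalGraph (μ : Measure E) (Ω : Opens E) (L : (E → ℝ) → E → ℝ) :
    Set (Lp ℝ 2 μ × Lp ℝ 2 μ) :=
  {p | ∃ φ : 𝓓(Ω, ℝ), p.1 =ᵐ[μ] (φ : E → ℝ) ∧ p.2 =ᵐ[μ] L φ}

/-- The graph of the Friedrichs extension of the (densely defined, symmetric, semibounded)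
operator `S` whose graph is `G`: the restriction of the adjoint `S*` to the form domain of `S`.
The form domain consists of the limits of sequences `aₙ` of `dom S` which converge in `H` and are
Cauchy for the quadratic form `⟪a, S a⟫`. -/
def friedrichs {H : Type*} [NormedAddCommGroup H] [InnerProductSpace ℝ H] (G : Set (H × H)) :
    Set (H × H) :=
  {p | (∃ a : ℕ → H × H, (∀ n, a n ∈ G) ∧ Tendsto (fun n => (a n).1) atTop (𝓝 p.1) ∧
          Tendsto (fun mn : ℕ × ℕ => ⟪(a mn.1).1 - (a mn.2).1, (a mn.1).2 - (a mn.2).2⟫_ℝ)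
            (atTop ×ˢ atTop) (𝓝 0)) ∧
        ∀ q ∈ G, ⟪p.1, q.2⟫_ℝ = ⟪p.2, q.1⟫_ℝ}

/-- `K` is the heat kernel (with respect to `μ`, on `Ω`) of the differential expression `L`,
realized as a self-adjoint operator `D` in `L²(μ)` by the Friedrichs extension from the smooth
functions compactly supported in `Ω`: `K(t; ·, ·)` is continuous on `Ω × Ω` for `t > 0`, and `K` is
the Green function of the initial-value problem `(∂ₜ + D) u = 0`, `u(0) = f`, that is, for every
smooth `f` compactly supported in `Ω`, the function `u(t) = ∫ K(t; ·, y) f(y) dμ(y)`, `t > 0`,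
solves the heat equation in `L²(μ)` and tends to `f` as `t → 0⁺`. -/
structure IsHeatKernel (μ : Measure E) (Ω : Opens E) (L : (E → ℝ) → E → ℝ)
    (K : ℝ → E → E → ℝ) : Prop where
  continuousOn : ∀ t, 0 < t →
    ContinuousOn (fun p : E × E => K t p.1 p.2) ((Ω : Set E) ×ˢ (Ω : Set E))
  green : ∀ f : 𝓓(Ω, ℝ), ∃ u : ℝ → Lp ℝ 2 μ,
    (∀ t, 0 < t → u t =ᵐ[μ] fun x => ∫ y, K t x y * f y ∂μ) ∧
    (∀ t, 0 < t → ∃ w : Lp ℝ 2 μ,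
      (u t, w) ∈ friedrichs (minimalGraph μ Ω L) ∧ HasDerivAt u (-w) t) ∧
    u 0 =ᵐ[μ] (f : E → ℝ) ∧ Tendsto u (𝓝[>] 0) (𝓝 (u 0))

end Operator

end PartialWave

end

noncomputable section

namespace PartialWave

/-! ### Legendre polynomials: differential equation, orthogonality, bounds -/

section Legendre

/-! Multiplying a radial function by the zonal harmonic `P_l(⟨n, x⟩/‖x‖)` about a unit vector `n`
intertwines `D_l` with `D`, by the Legendre equation (`laplacian_lift`). Up to a constant factor
this lift is isometric from `L²(r² dr)` into `L²(ℝ³)`, and it carries the Friedrichs graph of `D_l`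
into that of `D` (`liftL2_mem_friedrichs`). Heat solutions of a symmetric operator are determined by
their initial value (`IsHeatSolution.unique`), so lifting commutes with the two heat flows. Read on
the kernels, this is a Funk–Hecke formula (`angular_kernel`): the integral of `P_l(⟨n, ξ⟩) K(t; x,
rξ)` over the unit sphere is `P_l(⟨n, x⟩/‖x‖) K_l(t; ‖x‖, r)`.

The rest follows from this formula. Its right-hand side does not change when a rotation acts on `n`
and `x` together, and zonal polynomials are total among continuous functions on the sphere, so `K`
is rotation invariant (`kernel_isometry`) and depends on the angles through `cos γ` alone. Taking
`n` along `x` and reducing the surface integral to one over `[-1, 1]` (`integral_zonal`) gives the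
formula for `K_l`.

For the converse series continuity of `K` alone would not give convergence; positivity does. The
flow from time `0` to `t` is an inner product of states at time `t / 2`, so `K_l(t; r, r) ≥ 0` and
`2|K_l(t; r, r')| ≤ K_l(t; r, r) + K_l(t; r', r')` (`IsHeatKernel.diag_bounds`). A continuous
function on `[-1, 1]` with nonnegative Legendre coefficients has a summable Legendre series
(`summable_legendreCoeff_of_nonneg`); this settles `r = r'`, and the inequality then settles all `r,
r'`. Since `|P_l| ≤ 1`, the series converges uniformly, and completeness identifies its sum
(`hasSum_legendre`). -/

lemma legendre_ode_aux (l j : ℕ) :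
    (X ^ 2 - 1) * derivative^[j + 2] ((X ^ 2 - 1 : ℝ[X]) ^ l)
      + C (2 * ((j : ℝ) + 1) - 2 * l) * X * derivative^[j + 1] ((X ^ 2 - 1 : ℝ[X]) ^ l)
      + C (((j : ℝ) + 1) * j - 2 * l * (j + 1)) * derivative^[j] ((X ^ 2 - 1 : ℝ[X]) ^ l) = 0 := by
  induction j with
  | zero =>
    -- The first-order equation of `(X² - 1)^l`. Its derivative is the case `j = 0`, and every
    -- further derivative raises `j` by one.
    have h : (X ^ 2 - 1) * derivative ((X ^ 2 - 1 : ℝ[X]) ^ l)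
        = C (2 * (l : ℝ)) * X * (X ^ 2 - 1 : ℝ[X]) ^ l := by
      rcases l with _ | l
      · simp
      · simp only [derivative_pow, derivative_sub, derivative_X, derivative_one, map_mul]
        simp only [Nat.add_sub_cancel, map_natCast, map_ofNat]
        push_cast
        ring
    have h' := congrArg derivative h
    simp only [derivative_mul, derivative_sub, derivative_X_pow, derivative_one, derivative_X,
      derivative_C] at h'
    simp only [Function.iterate_succ', Function.iterate_zero, Function.comp, id]
    simp only [map_sub, map_mul, map_add, map_natCast, map_ofNat, map_one, Nat.cast_zero,
      Nat.cast_ofNat, map_zero] at h' ⊢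
    linear_combination h'
  | succ j ih =>
    have h' := congrArg derivative ih
    simp only [derivative_mul, derivative_sub, derivative_X_pow, derivative_one, derivative_X,
      derivative_C, derivative_add, derivative_zero, ← Function.iterate_succ_apply'] at h'
    simp only [map_sub, map_mul, map_add, map_natCast, map_ofNat, map_one,
      Nat.cast_ofNat, Nat.cast_one, Nat.cast_add, Nat.succ_eq_add_one] at h' ⊢
    linear_combination h'

lemma legendre_ode (l : ℕ) :
    (1 - X ^ 2) * derivative (derivative (legendre l)) - 2 * X * derivative (legendre l)
      + C ((l : ℝ) * (l + 1)) * legendre l = 0 := by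
  have h := legendre_ode_aux l l
  simp only [legendre, derivative_mul, derivative_C, ← Function.iterate_succ_apply',
    zero_mul, zero_add]
  simp only [map_sub, map_mul, map_add, map_natCast, map_ofNat, map_one, 
    Nat.succ_eq_add_one] at h ⊢
  linear_combination (-C (1 / (2 ^ l * (l.factorial : ℝ)))) * h

/-- Serves at the endpoints `a = ±1`, where `(X² - 1)^l` has the Taylor expansion `(X + 2a)^l X^l`,
whose coefficients up to order `l` are visible. -/
lemma eval_iterate_derivative_eq (p : ℝ[X]) (l : ℕ) (a : ℝ) :
    (derivative^[l] p).eval a = l.factorial * (taylor a p).coeff l := by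
  rw [taylor_coeff, ← factorial_smul_hasseDeriv]
  simp

lemma legendre_eval_one (l : ℕ) : (legendre l).eval 1 = 1 := by
  have h : taylor (1 : ℝ) ((X ^ 2 - 1) ^ l) = (X + C 2) ^ l * X ^ l := by
    rw [taylor_pow, ← mul_pow]
    congr 1
    simp only [map_sub, taylor_one, taylor_pow, taylor_X, map_one, map_ofNat]
    ring
  rw [legendre, eval_mul, eval_C, eval_iterate_derivative_eq, h, coeff_mul_X_pow', if_pos le_rfl,
    Nat.sub_self, coeff_zero_eq_eval_zero]
  have : (l.factorial : ℝ) ≠ 0 := by positivity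
  simp
  field_simp

lemma legendre_eval_neg_one (l : ℕ) : (legendre l).eval (-1) = (-1) ^ l := by
  have h : taylor (-1 : ℝ) ((X ^ 2 - 1) ^ l) = (X - C 2) ^ l * X ^ l := by
    rw [taylor_pow, ← mul_pow]
    congr 1
    simp only [map_sub, taylor_one, taylor_pow, taylor_X, map_one, map_ofNat, map_neg]
    ring
  rw [legendre, eval_mul, eval_C, eval_iterate_derivative_eq, h, coeff_mul_X_pow', if_pos le_rfl,
    Nat.sub_self, coeff_zero_eq_eval_zero]
  have : (l.factorial : ℝ) ≠ 0 := by positivity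
  simp only [eval_pow, eval_sub, eval_X, eval_C, zero_sub]
  rw [show (-2 : ℝ) ^ l = (-1) ^ l * 2 ^ l by rw [← mul_pow]; norm_num]
  field_simp

/-- Sonin's argument: by the Legendre equation `F = l(l+1) P² + (1 - x²) P'²` has derivative `2x
P'²`, so on `[-1, 1]` it is largest at the endpoints, where it equals `l(l+1)`. -/
lemma abs_legendre_eval_le (l : ℕ) {s : ℝ} (hs : s ∈ Icc (-1 : ℝ) 1) :
    |(legendre l).eval s| ≤ 1 := by
  rcases Nat.eq_zero_or_pos l with rfl | hl
  · simp [legendre]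
  have hl' : (0 : ℝ) < l := by exact_mod_cast hl
  set c : ℝ := (l : ℝ) * (l + 1) with hc
  have hc0 : 0 < c := by positivity
  set P := legendre l with hP
  set F : ℝ → ℝ := fun x => c * (P.eval x) ^ 2 + (1 - x ^ 2) * (P.derivative.eval x) ^ 2 with hF
  have hd : ∀ x, HasDerivAt F (2 * x * (P.derivative.eval x) ^ 2) x := by
    intro x
    have h1 := ((P.hasDerivAt x).pow 2).const_mul c
    have h2 := (((hasDerivAt_id x).pow 2).const_sub 1).mul ((P.derivative.hasDerivAt x).pow 2)
    refine (h1.add h2).congr_deriv ?_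
    have ode := congrArg (eval x) (legendre_ode l)
    simp only [eval_add, eval_sub, eval_mul, eval_pow, eval_X, eval_one, eval_C, eval_zero,
      eval_ofNat] at ode
    rw [← hP, ← hc] at ode
    simp
    linear_combination 2 * (P.derivative.eval x) * ode
  have hcont : Continuous F := continuous_iff_continuousAt.2 fun x => (hd x).continuousAt
  have hF1 : F 1 = c := by simp [hF, hP, legendre_eval_one]
  have hF2 : F (-1) = c := by
    simp [hF, hP, legendre_eval_neg_one, ← pow_mul, mul_comm l 2]
  have hle : F s ≤ c := by
    rcases le_total 0 s with h | h
    · have : MonotoneOn F (Icc 0 1) := by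
        refine monotoneOn_of_deriv_nonneg (convex_Icc 0 1) hcont.continuousOn
          (fun x _ => (hd x).differentiableAt.differentiableWithinAt) fun x hx => ?_
        rw [(hd x).deriv]
        rw [interior_Icc] at hx
        have := hx.1
        positivity
      exact hF1 ▸ this ⟨h, hs.2⟩ ⟨zero_le_one, le_rfl⟩ hs.2
    · have : AntitoneOn F (Icc (-1) 0) := by
        refine antitoneOn_of_deriv_nonpos (convex_Icc _ 0) hcont.continuousOn
          (fun x _ => (hd x).differentiableAt.differentiableWithinAt) fun x hx => ?_
        rw [(hd x).deriv]
        rw [interior_Icc] at hx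
        have := hx.2
        nlinarith [sq_nonneg (P.derivative.eval x)]
      exact hF2 ▸ this ⟨le_rfl, by norm_num⟩ ⟨hs.1, h⟩ hs.1
  have h3 : 0 ≤ (1 - s ^ 2) * (P.derivative.eval s) ^ 2 :=
    mul_nonneg (by nlinarith [hs.1, hs.2]) (sq_nonneg _)
  have h4 : c * (P.eval s) ^ 2 ≤ c * 1 := by simp only [hF] at hle; linarith
  exact (sq_le_one_iff_abs_le_one _).1 (le_of_mul_le_mul_left h4 hc0)

lemma intervalIntegral_derivative_mul (p q : ℝ[X]) (h1 : p.eval 1 = 0) (h2 : p.eval (-1) = 0) :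
    ∫ s in (-1 : ℝ)..1, (derivative p).eval s * q.eval s
      = -∫ s in (-1 : ℝ)..1, p.eval s * (derivative q).eval s := by
  have h := intervalIntegral.integral_mul_deriv_eq_deriv_mul
    (u := fun s => p.eval s) (v := fun s => q.eval s) (a := -1) (b := 1)
    (fun x _ => p.hasDerivAt x) (fun x _ => q.hasDerivAt x)
    ((Polynomial.continuous _).intervalIntegrable _ _)
    ((Polynomial.continuous _).intervalIntegrable _ _)
  simp only [h1, h2, zero_mul, sub_zero, zero_sub] at h
  rw [h, neg_neg]

lemma eval_iterate_derivative_rodrigues {l j : ℕ} (hj : j < l) {a : ℝ} (ha : a ^ 2 = 1) :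
    (derivative^[j] ((X ^ 2 - 1 : ℝ[X]) ^ l)).eval a = 0 := by
  have h : taylor a ((X ^ 2 - 1) ^ l) = (X + C (2 * a)) ^ l * X ^ l := by
    rw [taylor_pow, ← mul_pow]
    congr 1
    simp only [map_sub, taylor_one, taylor_pow, taylor_X, map_mul, map_one, map_ofNat]
    have : (C a : ℝ[X]) ^ 2 = 1 := by rw [← C_pow, ha, C_1]
    linear_combination this
  rw [eval_iterate_derivative_eq, h, coeff_mul_X_pow', if_neg (by omega), mul_zero]

lemma integral_rodrigues (l : ℕ) (q : ℝ[X]) (j : ℕ) (hj : j ≤ l) :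
    ∫ s in (-1 : ℝ)..1, (derivative^[j] ((X ^ 2 - 1 : ℝ[X]) ^ l)).eval s * q.eval s
      = (-1) ^ j * ∫ s in (-1 : ℝ)..1, (s ^ 2 - 1) ^ l * (derivative^[j] q).eval s := by
  induction j generalizing q with
  | zero => simp
  | succ j ih =>
    simp only [Function.iterate_succ_apply']
    rw [intervalIntegral_derivative_mul _ _ (eval_iterate_derivative_rodrigues (by omega) (by norm_num))
      (eval_iterate_derivative_rodrigues (by omega) (by norm_num)), ih _ (by omega),
      ← Function.iterate_succ_apply, Function.iterate_succ_apply']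
    ring

/-- Integrate by parts `l` times in Rodrigues' formula; the boundary terms vanish because `±1` are
zeros of order `l` of `(X² - 1)^l`. -/
lemma integral_legendre_mul (l : ℕ) (q : ℝ[X]) :
    ∫ s in (-1 : ℝ)..1, (legendre l).eval s * q.eval s
      = 1 / (2 ^ l * (l.factorial : ℝ)) *
        ∫ s in (-1 : ℝ)..1, (1 - s ^ 2) ^ l * (derivative^[l] q).eval s := by
  simp only [legendre, eval_mul, eval_C, mul_assoc]
  rw [intervalIntegral.integral_const_mul, integral_rodrigues l q l le_rfl,
    ← intervalIntegral.integral_const_mul (μ := volume) ((-1 : ℝ) ^ l)]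
  congr 2
  ext s
  rw [← mul_assoc, ← mul_pow]
  ring

lemma natDegree_legendre_le (l : ℕ) : (legendre l).natDegree ≤ l := by
  rw [legendre]
  refine (natDegree_C_mul_le _ _).trans ((natDegree_iterate_derivative _ _).trans ?_)
  have h : ((X ^ 2 - 1 : ℝ[X]) ^ l).natDegree ≤ l * 2 :=
    natDegree_pow_le_of_le l (by compute_degree)
  omega

lemma degree_legendre (l : ℕ) : (legendre l).degree = l := by
  have hm : ((X ^ 2 - 1 : ℝ[X]) ^ l).coeff (l + l) = 1 := by
    have h : (X ^ 2 - 1 : ℝ[X]).Monic := by monicity!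
    have h2 : (X ^ 2 - 1 : ℝ[X]).natDegree = 2 := by compute_degree!
    have := (h.pow l).coeff_natDegree
    rwa [h.natDegree_pow, h2, mul_two] at this
  refine degree_eq_of_le_of_coeff_ne_zero (degree_le_of_natDegree_le (natDegree_legendre_le l)) ?_
  rw [legendre, coeff_C_mul, coeff_iterate_derivative, hm]
  have h1 : ((l + l).descFactorial l : ℝ) ≠ 0 := by
    exact_mod_cast (Nat.pos_iff_ne_zero.1 (Nat.descFactorial_pos.2 (by omega)))
  have : (l.factorial : ℝ) ≠ 0 := by positivity
  simp [h1, this]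

lemma span_legendre : Submodule.span ℝ (range legendre) = ⊤ :=
  Polynomial.Sequence.span ⟨legendre, degree_legendre⟩ fun i =>
    isUnit_iff_ne_zero.2 (leadingCoeff_ne_zero.2
      (degree_ne_bot.1 (by rw [show (⟨legendre, degree_legendre⟩ : Polynomial.Sequence ℝ) i
        = legendre i from rfl, degree_legendre]; simp)))

lemma integral_legendre_mul_eq_zero {l : ℕ} {q : ℝ[X]} (h : q.degree < l) :
    ∫ s in (-1 : ℝ)..1, (legendre l).eval s * q.eval s = 0 := by
  rw [integral_legendre_mul, iterate_derivative_eq_zero_of_degree_lt h]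
  simp

lemma integral_legendre_mul_legendre_of_ne {l m : ℕ} (h : l ≠ m) :
    ∫ s in (-1 : ℝ)..1, (legendre l).eval s * (legendre m).eval s = 0 := by
  rcases lt_or_gt_of_ne h with h | h
  · simp_rw [mul_comm (eval _ (legendre l))]
    exact integral_legendre_mul_eq_zero (by rw [degree_legendre]; exact_mod_cast h)
  · exact integral_legendre_mul_eq_zero (by rw [degree_legendre]; exact_mod_cast h)

lemma integral_legendre_sq (l : ℕ) :
    ∫ s in (-1 : ℝ)..1, (legendre l).eval s * (legendre l).eval s = 2 / (2 * (l : ℝ) + 1) := by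
  set P := legendre l with hP
  set I := ∫ s in (-1 : ℝ)..1, P.eval s * P.eval s with hI
  have hcont : ∀ p : ℝ[X], IntervalIntegrable (fun s => p.eval s) volume (-1) 1 :=
    fun p => (Polynomial.continuous _).intervalIntegrable _ _
  -- The leading terms of `X P'` and `l P` cancel, so the difference is orthogonal to `P`. Together
  -- with the integral `2` of `(X P²)'` this yields `(2l + 1) I = 2`.
  have h1 : ∫ s in (-1 : ℝ)..1, P.eval s * (X * derivative P - C (l : ℝ) * P).eval s = 0 := by
    rcases Nat.eq_zero_or_pos l with h0 | h0
    · subst h0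
      simp [hP, legendre]
    refine integral_legendre_mul_eq_zero ?_
    rw [degree_lt_iff_coeff_zero]
    intro m hm
    obtain ⟨m, rfl⟩ : ∃ m', m = m' + 1 := ⟨m - 1, by omega⟩
    rw [coeff_sub, coeff_X_mul, coeff_C_mul, coeff_derivative]
    rcases hm.eq_or_lt with h | h
    · rw [h]; push_cast; ring
    · rw [coeff_eq_zero_of_natDegree_lt ((natDegree_legendre_le l).trans_lt h)]; simp
  have h2 : ∫ s in (-1 : ℝ)..1, P.eval s * (X * derivative P).eval s = l * I := by
    have : ∀ s, P.eval s * (X * derivative P - C (l : ℝ) * P).eval s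
        = (P * (X * derivative P)).eval s - l * (P * P).eval s := by
      intro s; simp; ring
    simp_rw [this] at h1
    rw [intervalIntegral.integral_sub (hcont _) ((hcont _).const_mul _),
      intervalIntegral.integral_const_mul] at h1
    simp only [eval_mul] at h1 hI ⊢
    rw [hI]; linarith
  have h3 : ∫ s in (-1 : ℝ)..1, (derivative (X * (P * P))).eval s = 2 := by
    rw [intervalIntegral.integral_eq_sub_of_hasDerivAt (f := fun s => (X * (P * P)).eval s)
      (fun x _ => Polynomial.hasDerivAt _ x) (hcont _)]
    simp [hP, legendre_eval_one, legendre_eval_neg_one, ← pow_add, ← two_mul]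
  have h4 : ∀ s, (derivative (X * (P * P))).eval s
      = (P * P).eval s + 2 * (P * (X * derivative P)).eval s := by
    intro s; simp; ring
  simp_rw [h4] at h3
  rw [intervalIntegral.integral_add (hcont _) ((hcont _).const_mul _),
      intervalIntegral.integral_const_mul] at h3
  simp only [eval_mul] at h3 hI h2
  rw [h2, ← hI] at h3
  rw [eq_div_iff (by positivity)]
  linarith

/-- After `l` integrations by parts only derivatives of `(1 + s)^n` remain, and these are
nonnegative on `[-1, 1]`. These powers are the peaked weights of the summability argument. -/
lemma integral_legendre_mul_one_add_pow_nonneg (l n : ℕ) :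
    0 ≤ ∫ s in (-1 : ℝ)..1, (1 + s) ^ n * (legendre l).eval s := by
  have h := integral_legendre_mul l ((X + C 1) ^ n)
  simp only [eval_pow, eval_add, eval_X, eval_C, iterate_derivative_X_add_pow] at h
  have h2 : (fun s : ℝ => (1 + s) ^ n * (legendre l).eval s)
      = fun s => (legendre l).eval s * (s + 1) ^ n := by
    ext s; ring
  rw [h2, h]
  refine mul_nonneg (by positivity) (intervalIntegral.integral_nonneg (by norm_num) fun s hs => ?_)
  have h3 : 0 ≤ 1 - s ^ 2 := by nlinarith [hs.1, hs.2]
  have h4 : 0 ≤ s + 1 := by linarith [hs.1]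
  simp
  positivity

end Legendre

/-! ### Legendre series of continuous functions -/

section LegendreSeries

/-- If `a` is orthogonal to `h` and uniformly `ε`-close to it, then `∫ h² = ∫ (h - a) h ≤ ε ∫ |h|`.
Used with polynomials on `[-1, 1]` and with exponentials on the sphere. -/
lemma ae_eq_zero_of_orthogonal_approx {α : Type*} [MeasurableSpace α] {μ : Measure α}
    [IsFiniteMeasure μ] {h : α → ℝ} {M : ℝ} (hm : AEStronglyMeasurable h μ)
    (hM : ∀ᵐ x ∂μ, |h x| ≤ M)
    (H : ∀ ε : ℝ, 0 < ε → ∃ a : α → ℝ, AEStronglyMeasurable a μ ∧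
      (∀ᵐ x ∂μ, |a x - h x| ≤ ε) ∧ ∫ x, a x * h x ∂μ = 0) : h =ᵐ[μ] 0 := by
  have hint : Integrable h μ := Integrable.of_bound hm M hM
  have hsq : Integrable (fun x => h x * h x) μ := hint.mul_bdd hm hM
  have hle : ∀ ε : ℝ, 0 < ε → ∫ x, h x * h x ∂μ ≤ ε * ∫ x, |h x| ∂μ := by
    intro ε hε
    obtain ⟨a, ham, hah, ha0⟩ := H ε hε
    have hai : Integrable (fun x => a x * h x) μ := by
      refine hint.bdd_mul ham (c := ε + M) ?_
      filter_upwards [hah, hM] with x h1 h2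
      calc |a x| = |(a x - h x) + h x| := by ring_nf
        _ ≤ _ := (abs_add_le _ _).trans (add_le_add h1 h2)
    rw [← sub_zero (∫ x, h x * h x ∂μ), ← ha0, ← integral_sub hsq hai, ← integral_const_mul]
    refine integral_mono_ae (hsq.sub hai) (hint.abs.const_mul ε) ?_
    filter_upwards [hah] with x hx
    calc h x * h x - a x * h x = -((a x - h x) * h x) := by ring
      _ ≤ |(a x - h x) * h x| := neg_le_abs _
      _ ≤ ε * |h x| := by rw [abs_mul]; gcongr
  have h0 : ∫ x, h x * h x ∂μ = 0 := by
    refine le_antisymm ?_ (integral_nonneg fun x => mul_self_nonneg _)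
    have : Tendsto (fun ε : ℝ => ε * ∫ x, |h x| ∂μ) (𝓝[>] 0) (𝓝 (0 * ∫ x, |h x| ∂μ)) :=
      (tendsto_id.mono_left nhdsWithin_le_nhds).mul_const _
    rw [zero_mul] at this
    exact ge_of_tendsto this (eventually_nhdsWithin_of_forall fun ε hε => hle ε hε)
  have := (integral_eq_zero_iff_of_nonneg (fun x => mul_self_nonneg (h x)) hsq).1 h0
  filter_upwards [this] with x hx
  simpa using hx

lemma forall_polynomial_of_legendre {p : ℝ[X] → Prop} (h0 : p 0)
    (hadd : ∀ q r, p q → p r → p (q + r)) (hsmul : ∀ (c : ℝ) q, p q → p (c • q))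
    (hP : ∀ l, p (legendre l)) (q : ℝ[X]) : p q := by
  have hq : q ∈ Submodule.span ℝ (range legendre) := by rw [span_legendre]; trivial
  induction hq using Submodule.span_induction with
  | mem x hx => obtain ⟨l, rfl⟩ := hx; exact hP l
  | zero => exact h0
  | add x y _ _ hx hy => exact hadd x y hx hy
  | smul c x _ hx => exact hsmul c x hx

/-- The `l`-th Legendre coefficient `∫_{-1}^1 P_l k`. -/
def legendreCoeff (k : ℝ → ℝ) (l : ℕ) : ℝ := ∫ s in (-1 : ℝ)..1, (legendre l).eval s * k s

lemma intervalIntegrable_eval_mul {k : ℝ → ℝ} (hk : ContinuousOn k (Icc (-1) 1)) (q : ℝ[X]) :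
    IntervalIntegrable (fun s => q.eval s * k s) volume (-1) 1 := by
  refine ContinuousOn.intervalIntegrable ?_
  rw [uIcc_of_le (by norm_num)]
  exact q.continuous.continuousOn.mul hk

lemma eqOn_zero_of_legendreCoeff_eq_zero {h : ℝ → ℝ} (hc : ContinuousOn h (Icc (-1) 1))
    (h0 : ∀ l, legendreCoeff h l = 0) : EqOn h 0 (Icc (-1) 1) := by
  have hpoly : ∀ q : ℝ[X], ∫ s in (-1 : ℝ)..1, q.eval s * h s = 0 := by
    refine forall_polynomial_of_legendre (by simp) (fun q r hq hr => ?_) (fun c q hq => ?_) h0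
    · simp only [eval_add, add_mul]
      rw [intervalIntegral.integral_add (intervalIntegrable_eval_mul hc _)
        (intervalIntegrable_eval_mul hc _), hq, hr, add_zero]
    · simp only [eval_smul, smul_eq_mul, mul_assoc]
      rw [intervalIntegral.integral_const_mul, hq, mul_zero]
  obtain ⟨M, hM⟩ := isCompact_Icc.exists_bound_of_continuousOn hc
  refine Measure.eqOn_Icc_of_ae_eq (μ := volume) (by norm_num) ?_ hc continuousOn_const
  refine ae_eq_zero_of_orthogonal_approx (M := M) (hc.aestronglyMeasurable measurableSet_Icc)
    ((ae_restrict_iff' measurableSet_Icc).2 (ae_of_all _ hM)) fun ε hε => ?_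
  obtain ⟨p, hp⟩ := exists_polynomial_near_of_continuousOn _ _ h hc ε hε
  refine ⟨fun s => p.eval s, p.continuous.aestronglyMeasurable,
    (ae_restrict_iff' measurableSet_Icc).2 (ae_of_all _ fun x hx => (hp x hx).le), ?_⟩
  rw [integral_Icc_eq_integral_Ioc, ← intervalIntegral.integral_of_le (by norm_num)]
  exact hpoly p

/-- A polynomial has a finite Legendre expansion, so no convergence is involved; by linearity it
suffices to take `q` a Legendre polynomial. -/
lemma legendre_parseval {k : ℝ → ℝ} (hk : ContinuousOn k (Icc (-1) 1)) (q : ℝ[X]) :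
    ∃ N₀, ∀ N ≥ N₀, ∫ s in (-1 : ℝ)..1, q.eval s * k s
      = ∑ l ∈ Finset.range N, (2 * (l : ℝ) + 1) / 2 * legendreCoeff (fun s => q.eval s) l
          * legendreCoeff k l := by
  have hci : ∀ (l : ℕ) (q : ℝ[X]),
      IntervalIntegrable (fun s => (legendre l).eval s * q.eval s) volume (-1) 1 :=
    fun l q => intervalIntegrable_eval_mul q.continuous.continuousOn _
  induction q using forall_polynomial_of_legendre with
  | h0 => exact ⟨0, fun N _ => by simp [legendreCoeff]⟩
  | hadd q r hq hr =>
    obtain ⟨N1, h1⟩ := hq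
    obtain ⟨N2, h2⟩ := hr
    refine ⟨max N1 N2, fun N hN => ?_⟩
    simp only [eval_add, add_mul]
    rw [intervalIntegral.integral_add (intervalIntegrable_eval_mul hk _)
        (intervalIntegrable_eval_mul hk _), h1 N (le_of_max_le_left hN),
        h2 N (le_of_max_le_right hN), ← Finset.sum_add_distrib]
    refine Finset.sum_congr rfl fun l _ => ?_
    simp only [legendreCoeff, mul_add]
    rw [intervalIntegral.integral_add (hci l q) (hci l r)]
    ring
  | hsmul c q hq =>
    obtain ⟨N1, h1⟩ := hq
    refine ⟨N1, fun N hN => ?_⟩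
    simp only [eval_smul, smul_eq_mul, mul_assoc]
    rw [intervalIntegral.integral_const_mul, h1 N hN, Finset.mul_sum]
    refine Finset.sum_congr rfl fun l _ => ?_
    simp only [legendreCoeff]
    simp_rw [mul_left_comm _ c]
    rw [intervalIntegral.integral_const_mul]
    ring
  | hP m =>
    refine ⟨m + 1, fun N hN => ?_⟩
    rw [Finset.sum_eq_single m]
    · simp only [legendreCoeff, integral_legendre_sq]
      have : (2 * (m : ℝ) + 1) ≠ 0 := by positivity
      field_simp
    · intro l _ hl
      simp only [legendreCoeff, integral_legendre_mul_legendre_of_ne hl]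
      ring
    · intro hm
      exact absurd (Finset.mem_range.2 hN) hm

/-- The normalized weights `(1 + s)^n` concentrate at `s = 1` and have nonnegative Legendre
coefficients, which tend to `P_l(1) = 1`. By Parseval a partial sum weighted by these coefficients
is at most twice the mean of `k`, and `n → ∞` bounds the partial sums by `2 k(1)`. -/
lemma summable_legendreCoeff_of_nonneg {k : ℝ → ℝ} (hk : ContinuousOn k (Icc (-1) 1))
    (hnn : ∀ l, 0 ≤ legendreCoeff k l) :
    Summable fun l : ℕ => (2 * (l : ℝ) + 1) * legendreCoeff k l := by
  have hIcc : ∀ g : ℝ → ℝ, ∫ s in (-1 : ℝ)..1, g s = ∫ s in Icc (-1 : ℝ) 1, g s := fun g => by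
    rw [integral_Icc_eq_integral_Ioc, ← intervalIntegral.integral_of_le (by norm_num)]
  have hpeak : ∀ g : ℝ → ℝ, ContinuousOn g (Icc (-1) 1) → Tendsto (fun n : ℕ =>
      (∫ s in (-1 : ℝ)..1, (1 + s) ^ n)⁻¹ * ∫ s in (-1 : ℝ)..1, (1 + s) ^ n * g s)
      atTop (𝓝 (g 1)) := by
    intro g hg
    simp only [hIcc]
    refine tendsto_setIntegral_pow_smul_of_unique_maximum_of_isCompact_of_continuousOn
      (c := fun s => 1 + s) isCompact_Icc (by fun_prop) ?_ ?_ (by norm_num) ?_ hg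
    · intro y hy hne
      have := lt_of_le_of_ne hy.2 hne
      linarith
    · intro x hx; linarith [hx.1]
    · rw [closure_interior_Icc (by norm_num)]; constructor <;> norm_num
  have hmass : ∀ n : ℕ, 0 ≤ (∫ s in (-1 : ℝ)..1, (1 + s) ^ n)⁻¹ := fun n =>
    inv_nonneg.2 (intervalIntegral.integral_nonneg (by norm_num) fun s hs =>
      pow_nonneg (by linarith [hs.1]) n)
  have hbound : ∀ N : ℕ, ∑ l ∈ Finset.range N, (2 * (l : ℝ) + 1) * legendreCoeff k l
      ≤ 2 * k 1 := by
    intro N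
    have h1 : Tendsto (fun n : ℕ => ∑ l ∈ Finset.range N, (2 * (l : ℝ) + 1) *
        ((∫ s in (-1 : ℝ)..1, (1 + s) ^ n)⁻¹ *
          ∫ s in (-1 : ℝ)..1, (1 + s) ^ n * (legendre l).eval s) * legendreCoeff k l) atTop
        (𝓝 (∑ l ∈ Finset.range N, (2 * (l : ℝ) + 1) * (legendre l).eval 1
          * legendreCoeff k l)) :=
      tendsto_finsetSum _ fun l _ =>
        ((hpeak _ (legendre l).continuous.continuousOn).const_mul _).mul_const _
    simp only [legendre_eval_one, mul_one] at h1
    refine le_of_tendsto_of_tendsto' h1 ((hpeak k hk).const_mul 2) fun n => ?_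
    obtain ⟨N₀, h⟩ := legendre_parseval hk ((1 + X) ^ n)
    have h2 := h (max N N₀) (le_max_right _ _)
    simp only [eval_pow, eval_add, eval_one, eval_X] at h2
    rw [h2, Finset.mul_sum, Finset.mul_sum]
    have hco : ∀ l, legendreCoeff (fun s => (1 + s) ^ n) l
        = ∫ s in (-1 : ℝ)..1, (1 + s) ^ n * (legendre l).eval s := fun l => by
      simp only [legendreCoeff, mul_comm]
    have hterm : ∀ l : ℕ, (2 * (l : ℝ) + 1) *
        ((∫ s in (-1 : ℝ)..1, (1 + s) ^ n)⁻¹ *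
          ∫ s in (-1 : ℝ)..1, (1 + s) ^ n * (legendre l).eval s) * legendreCoeff k l
        = 2 * ((∫ s in (-1 : ℝ)..1, (1 + s) ^ n)⁻¹ * ((2 * (l : ℝ) + 1) / 2
          * legendreCoeff (fun s => (1 + s) ^ n) l * legendreCoeff k l)) := by
      intro l; rw [hco]; ring
    simp only [hterm]
    refine Finset.sum_le_sum_of_subset_of_nonneg
      (Finset.range_mono (le_max_left _ _)) fun l _ _ => ?_
    have h3 := integral_legendre_mul_one_add_pow_nonneg l n
    rw [← hco] at h3
    have := hnn l
    have := hmass n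
    positivity
  exact summable_of_sum_range_le (fun l => mul_nonneg (by positivity) (hnn l)) hbound

/-- The Weierstrass M-test makes the sum continuous and allows termwise integration, so it has the
coefficients of `k`; completeness of the Legendre polynomials concludes. -/
lemma hasSum_legendre {k : ℝ → ℝ} (hk : ContinuousOn k (Icc (-1) 1))
    (hs : Summable fun l : ℕ => (2 * (l : ℝ) + 1) * |legendreCoeff k l|) {s : ℝ}
    (hsI : s ∈ Icc (-1 : ℝ) 1) :
    HasSum (fun l : ℕ => (2 * (l : ℝ) + 1) / 2 * (legendre l).eval s * legendreCoeff k l)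
      (k s) := by
  set F : ℕ → ℝ → ℝ := fun l s =>
    (2 * (l : ℝ) + 1) / 2 * (legendre l).eval s * legendreCoeff k l with hF
  set u : ℕ → ℝ := fun l => (2 * (l : ℝ) + 1) * |legendreCoeff k l| with hu
  have hFu : ∀ l, ∀ x ∈ Icc (-1 : ℝ) 1, ‖F l x‖ ≤ u l := by
    intro l x hx
    have h1 := abs_legendre_eval_le l hx
    simp only [hF, hu, Real.norm_eq_abs, abs_mul]
    rw [abs_of_nonneg (by positivity : (0 : ℝ) ≤ (2 * (l : ℝ) + 1) / 2)]
    gcongr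
    have h2 : (0 : ℝ) ≤ 2 * (l : ℝ) + 1 := by positivity
    nlinarith [abs_nonneg ((legendre l).eval x)]
  have hFc : ∀ l, ContinuousOn (F l) (Icc (-1) 1) := fun l => by
    have := (legendre l).continuous
    fun_prop
  have hσc : ContinuousOn (fun x => ∑' l, F l x) (Icc (-1) 1) :=
    continuousOn_tsum hFc hs hFu
  have hFs : ∀ x ∈ Icc (-1 : ℝ) 1, HasSum (fun l => F l x) (∑' l, F l x) := fun x hx =>
    (Summable.of_norm_bounded hs fun l => hFu l x hx).hasSum
  have huI : uIoc (-1 : ℝ) 1 ⊆ Icc (-1) 1 := by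
    rw [uIoc_of_le (by norm_num)]; exact Ioc_subset_Icc_self
  have hcoeff : ∀ m, legendreCoeff (fun x => k x - ∑' l, F l x) m = 0 := by
    intro m
    have h1 : HasSum (fun l => ∫ x in (-1 : ℝ)..1, (legendre m).eval x * F l x)
        (∫ x in (-1 : ℝ)..1, (legendre m).eval x * ∑' l, F l x) := by
      refine intervalIntegral.hasSum_integral_of_dominated_convergence (fun l _ => u l)
        (fun l => ?_) (fun l => ae_of_all _ fun x hx => ?_) (ae_of_all _ fun x _ => hs)
        intervalIntegrable_const
        (ae_of_all _ fun x hx => (hFs x (huI hx)).mul_left _)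
      · exact (((legendre m).continuous.continuousOn.mul (hFc l)).mono huI).aestronglyMeasurable
          measurableSet_uIoc
      · rw [norm_mul]
        calc _ ≤ 1 * u l := mul_le_mul (abs_legendre_eval_le m (huI hx)) (hFu l x (huI hx))
              (norm_nonneg _) zero_le_one
          _ = u l := one_mul _
    have h2 : ∀ l, ∫ x in (-1 : ℝ)..1, (legendre m).eval x * F l x
        = if l = m then legendreCoeff k m else 0 := by
      intro l
      have : ∀ x, (legendre m).eval x * F l x
          = ((2 * (l : ℝ) + 1) / 2 * legendreCoeff k l)
            * ((legendre m).eval x * (legendre l).eval x) := fun x => by simp only [hF]; ring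
      simp only [this]
      rw [intervalIntegral.integral_const_mul]
      split_ifs with h
      · subst h
        rw [integral_legendre_sq]
        have : (2 * (l : ℝ) + 1) ≠ 0 := by positivity
        field_simp
      · rw [integral_legendre_mul_legendre_of_ne (Ne.symm h), mul_zero]
    simp only [h2] at h1
    have h3 := h1.unique (hasSum_ite_eq m (legendreCoeff k m))
    simp only [legendreCoeff, mul_sub]
    rw [intervalIntegral.integral_sub (intervalIntegrable_eval_mul hk _)
      (intervalIntegrable_eval_mul hσc _), h3, legendreCoeff, sub_self]
  have := eqOn_zero_of_legendreCoeff_eq_zero (hk.sub hσc) hcoeff hsI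
  have h4 : k s = ∑' l, F l s := by simpa [sub_eq_zero] using this
  rw [h4]
  exact hFs s hsI

end LegendreSeries

/-! ### Friedrichs extensions and uniqueness for the abstract heat equation -/

section Hilbert

variable {H : Type*} [NormedAddCommGroup H] [InnerProductSpace ℝ H]

/-- The graph `G` is that of a symmetric operator with lower bound `-c`. -/
structure IsSemibounded (G : Submodule ℝ (H × H)) (c : ℝ) : Prop where
  symm : ∀ a ∈ G, ∀ b ∈ G, ⟪a.1, b.2⟫_ℝ = ⟪a.2, b.1⟫_ℝ
  bound : ∀ a ∈ G, -c * ‖a.1‖ ^ 2 ≤ ⟪a.1, a.2⟫_ℝ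

/-- The form of an operator, shifted by `c`. -/
def shiftedForm (c : ℝ) (a b : H × H) : ℝ := ⟪a.1, b.2⟫_ℝ + c * ⟪a.1, b.1⟫_ℝ

variable {G : Submodule ℝ (H × H)} {c : ℝ}

lemma IsSemibounded.shiftedForm_self_nonneg (hG : IsSemibounded G c) {a : H × H} (ha : a ∈ G) :
    0 ≤ shiftedForm c a a := by
  have := hG.bound a ha
  rw [shiftedForm, real_inner_self_eq_norm_sq]
  linarith

lemma IsSemibounded.shiftedForm_sq_le (hG : IsSemibounded G c) {a b : H × H} (ha : a ∈ G)
    (hb : b ∈ G) : shiftedForm c a b ^ 2 ≤ shiftedForm c a a * shiftedForm c b b := by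
  have hba : shiftedForm c b a = shiftedForm c a b := by
    rw [shiftedForm, shiftedForm, hG.symm b hb a ha, real_inner_comm b.1 a.1,
      real_inner_comm b.2 a.1]
  have h : ∀ t : ℝ, 0 ≤ shiftedForm c b b * (t * t) + 2 * shiftedForm c a b * t
      + shiftedForm c a a := by
    intro t
    have h1 := hG.shiftedForm_self_nonneg (G.add_mem ha (G.smul_mem t hb))
    have h2 : shiftedForm c (a + t • b) (a + t • b) = shiftedForm c b b * (t * t)
        + (shiftedForm c a b + shiftedForm c b a) * t + shiftedForm c a a := by
      simp only [shiftedForm, Prod.fst_add, Prod.snd_add, Prod.smul_fst, Prod.smul_snd,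
        inner_add_left, inner_add_right, real_inner_smul_left, real_inner_smul_right]
      ring
    rw [h2, hba, ← two_mul] at h1
    exact h1
  have := discrim_le_zero h
  rw [discrim] at this
  nlinarith

lemma IsSemibounded.tendsto_shiftedForm_sub {a : ℕ → H × H} {x : H}
    (h1 : Tendsto (fun n => (a n).1) atTop (𝓝 x))
    (h2 : Tendsto (fun mn : ℕ × ℕ => ⟪(a mn.1).1 - (a mn.2).1, (a mn.1).2 - (a mn.2).2⟫_ℝ)
            (atTop ×ˢ atTop) (𝓝 0)) :
    Tendsto (fun mn : ℕ × ℕ => shiftedForm c (a mn.1 - a mn.2) (a mn.1 - a mn.2))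
      (atTop ×ˢ atTop) (𝓝 0) := by
  have h3 : Tendsto (fun mn : ℕ × ℕ => (a mn.1).1 - (a mn.2).1) (atTop ×ˢ atTop) (𝓝 (x - x)) :=
    (h1.comp tendsto_fst).sub (h1.comp tendsto_snd)
  have h4 := h2.add ((h3.inner h3 (𝕜 := ℝ)).const_mul c)
  simpa [shiftedForm] using h4

lemma IsSemibounded.exists_shiftedForm_le (hG : IsSemibounded G c) {a : ℕ → H × H}
    (ha : ∀ n, a n ∈ G)
    (h : Tendsto (fun mn : ℕ × ℕ => shiftedForm c (a mn.1 - a mn.2) (a mn.1 - a mn.2))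
      (atTop ×ˢ atTop) (𝓝 0)) :
    ∃ M, ∀ᶠ n in atTop, shiftedForm c (a n) (a n) ≤ M := by
  have h1 := h.eventually (gt_mem_nhds one_pos)
  rw [prod_atTop_atTop_eq, eventually_atTop] at h1
  obtain ⟨⟨N1, N2⟩, hN⟩ := h1
  refine ⟨2 + 2 * shiftedForm c (a N2) (a N2), eventually_atTop.2 ⟨N1, fun n hn => ?_⟩⟩
  have h2 : shiftedForm c (a n - a N2) (a n - a N2) < 1 := hN (n, N2) ⟨hn, le_rfl⟩
  -- The parallelogram law for `a n - a N2` and `a N2`, with the square of their difference dropped,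
  -- bounds the form at `a n`.
  have h3 := hG.shiftedForm_self_nonneg (G.sub_mem (G.sub_mem (ha n) (ha N2)) (ha N2))
  have h4 : shiftedForm c (a n) (a n) + shiftedForm c (a n - a N2 - a N2) (a n - a N2 - a N2)
      = 2 * shiftedForm c (a n - a N2) (a n - a N2) + 2 * shiftedForm c (a N2) (a N2) := by
    simp only [shiftedForm, Prod.fst_sub, Prod.snd_sub, inner_sub_left, inner_sub_right]
    ring
  linarith

/-- The vectors `(b n).2` may be unbounded, so norm convergence is not enough. Cauchy–Schwarz for
the shifted form bounds the pairing with `a m - a n` by a form-small factor times a form-bounded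
one, and then `m → ∞`. -/
lemma IsSemibounded.tendsto_inner_sub (hG : IsSemibounded G c) {a b : ℕ → H × H} {x y : H}
    (ha : ∀ n, a n ∈ G) (hb : ∀ n, b n ∈ G)
    (ha1 : Tendsto (fun n => (a n).1) atTop (𝓝 x)) (hb1 : Tendsto (fun n => (b n).1) atTop (𝓝 y))
    (ha2 : Tendsto (fun mn : ℕ × ℕ => shiftedForm c (a mn.1 - a mn.2) (a mn.1 - a mn.2))
      (atTop ×ˢ atTop) (𝓝 0))
    (hb2 : ∃ M, ∀ᶠ n in atTop, shiftedForm c (b n) (b n) ≤ M) :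
    Tendsto (fun n => ⟪x - (a n).1, (b n).2⟫_ℝ) atTop (𝓝 0) := by
  obtain ⟨M, hM⟩ := hb2
  have hM1 : ∀ᶠ n in atTop, shiftedForm c (b n) (b n) ≤ max M 0 + 1 :=
    hM.mono fun n hn => by linarith [le_max_left M 0]
  have hMpos : 0 < max M 0 + 1 := by linarith [le_max_right M 0]
  set M' := max M 0 + 1
  have key : Tendsto (fun n => (⟪x - (a n).1, (b n).2⟫_ℝ + c * ⟪x - (a n).1, (b n).1⟫_ℝ) ^ 2)
      atTop (𝓝 0) := by
    rw [Metric.tendsto_atTop]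
    intro ε hε
    have h1 := ha2.eventually (gt_mem_nhds (show 0 < ε / 2 / M' by positivity))
    rw [prod_atTop_atTop_eq, eventually_atTop] at h1
    obtain ⟨⟨N1, N2⟩, hN⟩ := h1
    obtain ⟨N3, hN3⟩ := eventually_atTop.1 hM1
    refine ⟨max N2 N3, fun n hn => ?_⟩
    have h2 : ∀ m ≥ N1, (⟪(a m).1 - (a n).1, (b n).2⟫_ℝ + c * ⟪(a m).1 - (a n).1, (b n).1⟫_ℝ) ^ 2
        ≤ ε / 2 := by
      intro m hm
      have h3 := hG.shiftedForm_sq_le (G.sub_mem (ha m) (ha n)) (hb n)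
      have h4 : shiftedForm c (a m - a n) (a m - a n) < ε / 2 / M' :=
        hN (m, n) ⟨hm, le_of_max_le_left hn⟩
      have h5 := hN3 n (le_of_max_le_right hn)
      have h6 := hG.shiftedForm_self_nonneg (hb n)
      have h7 := hG.shiftedForm_self_nonneg (G.sub_mem (ha m) (ha n))
      calc _ ≤ _ := h3
        _ ≤ ε / 2 / M' * M' := by gcongr
        _ = ε / 2 := by field_simp
    have h3 : Tendsto (fun m => (⟪(a m).1 - (a n).1, (b n).2⟫_ℝ
        + c * ⟪(a m).1 - (a n).1, (b n).1⟫_ℝ) ^ 2) atTop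
        (𝓝 ((⟪x - (a n).1, (b n).2⟫_ℝ + c * ⟪x - (a n).1, (b n).1⟫_ℝ) ^ 2)) :=
      ((((ha1.sub_const _).inner tendsto_const_nhds (𝕜 := ℝ)).add
        (((ha1.sub_const _).inner tendsto_const_nhds (𝕜 := ℝ)).const_mul c)).pow 2)
    have h4 := le_of_tendsto h3 (eventually_atTop.2 ⟨N1, h2⟩)
    rw [Real.dist_eq, sub_zero, abs_of_nonneg (sq_nonneg _)]
    linarith
  have key2 : Tendsto (fun n => ⟪x - (a n).1, (b n).2⟫_ℝ + c * ⟪x - (a n).1, (b n).1⟫_ℝ)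
      atTop (𝓝 0) := by
    have := key.sqrt
    simp only [Real.sqrt_sq_eq_abs, Real.sqrt_zero] at this
    exact (tendsto_zero_iff_abs_tendsto_zero _).2 this
  have h1 : Tendsto (fun n => c * ⟪x - (a n).1, (b n).1⟫_ℝ) atTop (𝓝 (c * ⟪x - x, y⟫_ℝ)) :=
    ((ha1.const_sub x).inner hb1 (𝕜 := ℝ)).const_mul c
  simpa using key2.sub h1

/-- Along approximating sequences `⟪a n, S (b n)⟫ = ⟪b n, S (a n)⟫`; since `p` and `r` lie in the
adjoint, the two sides tend to `⟪p.2, r.1⟫` and `⟪r.2, p.1⟫`. Symmetry is all that the heat equation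
needs below; self-adjointness is not used. -/
lemma IsSemibounded.friedrichs_symm (hG : IsSemibounded G c) {p r : H × H}
    (hp : p ∈ friedrichs (G : Set (H × H))) (hr : r ∈ friedrichs (G : Set (H × H))) :
    ⟪p.1, r.2⟫_ℝ = ⟪p.2, r.1⟫_ℝ := by
  obtain ⟨⟨a, ha, ha1, ha2⟩, hpG⟩ := hp
  obtain ⟨⟨b, hb, hb1, hb2⟩, hrG⟩ := hr
  have ha3 := IsSemibounded.tendsto_shiftedForm_sub (c := c) ha1 ha2
  have hb3 := IsSemibounded.tendsto_shiftedForm_sub (c := c) hb1 hb2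
  have h1 : Tendsto (fun n => ⟪(a n).1, (b n).2⟫_ℝ) atTop (𝓝 ⟪p.2, r.1⟫_ℝ) := by
    have h2 := hG.tendsto_inner_sub ha hb ha1 hb1 ha3 (hG.exists_shiftedForm_le hb hb3)
    have h3 : Tendsto (fun n => ⟪p.1, (b n).2⟫_ℝ) atTop (𝓝 ⟪p.2, r.1⟫_ℝ) := by
      simp only [fun n => hpG (b n) (hb n)]
      exact tendsto_const_nhds.inner hb1
    have := h3.sub h2
    simpa [inner_sub_left] using this
  have h2 : Tendsto (fun n => ⟪(b n).1, (a n).2⟫_ℝ) atTop (𝓝 ⟪r.2, p.1⟫_ℝ) := by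
    have h2 := hG.tendsto_inner_sub hb ha hb1 ha1 hb3 (hG.exists_shiftedForm_le ha ha3)
    have h3 : Tendsto (fun n => ⟪r.1, (a n).2⟫_ℝ) atTop (𝓝 ⟪r.2, p.1⟫_ℝ) := by
      simp only [fun n => hrG (a n) (ha n)]
      exact tendsto_const_nhds.inner ha1
    have := h3.sub h2
    simpa [inner_sub_left] using this
  have h3 : ∀ n, ⟪(b n).1, (a n).2⟫_ℝ = ⟪(a n).1, (b n).2⟫_ℝ := fun n => by
    rw [hG.symm _ (ha n) _ (hb n), real_inner_comm]
  simp only [h3] at h2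
  rw [tendsto_nhds_unique h1 h2, real_inner_comm]

/-- `u` solves `u' = -A u` on `(0, ∞)` and is continuous at `0`, where `A` is a graph. -/
structure IsHeatSolution (A : Set (H × H)) (u : ℝ → H) : Prop where
  deriv : ∀ t, 0 < t → ∃ w, (u t, w) ∈ A ∧ HasDerivAt u (-w) t
  tendsto : Tendsto u (𝓝[>] 0) (𝓝 (u 0))

/-- By symmetry of `A` the function `s ↦ ⟪u s, v (t - s)⟫` has derivative zero. Stopping at `t / 2`
keeps the argument of `v` away from `0`. -/
lemma IsHeatSolution.inner_eq {A : Set (H × H)}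
    (hA : ∀ p ∈ A, ∀ r ∈ A, ⟪p.1, r.2⟫_ℝ = ⟪p.2, r.1⟫_ℝ) {u v : ℝ → H}
    (hu : IsHeatSolution A u) (hv : IsHeatSolution A v) {t : ℝ} (ht : 0 < t) :
    ⟪u 0, v t⟫_ℝ = ⟪u (t / 2), v (t / 2)⟫_ℝ := by
  set F : ℝ → ℝ := fun s => ⟪u s, v (t - s)⟫_ℝ with hF
  have hd : ∀ s, 0 < s → s < t → HasDerivAt F 0 s := by
    intro s hs hst
    obtain ⟨w, hw, hdu⟩ := hu.deriv s hs
    obtain ⟨z, hz, hdv⟩ := hv.deriv (t - s) (by linarith)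
    have h1 : HasDerivAt (fun s => v (t - s)) z s := by
      have := hdv.scomp s ((hasDerivAt_id s).const_sub t)
      rw [Function.comp_def] at this
      simpa using this
    refine (hdu.inner ℝ h1).congr_deriv ?_
    have := hA _ hw _ hz
    simp only at this
    rw [this, inner_neg_left]
    ring
  have hc : ContinuousOn F (Icc 0 (t / 2)) := by
    intro s hs
    rcases hs.1.eq_or_lt with h | h
    · subst h
      have h1 : ContinuousWithinAt u (Icc 0 (t / 2)) 0 := by
        have : ContinuousWithinAt u (Ici 0) 0 := by
          rw [continuousWithinAt_Ioi_iff_Ici.symm]; exact hu.tendsto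
        exact this.mono Icc_subset_Ici_self
      obtain ⟨z, -, hdv⟩ := hv.deriv t ht
      have h2 : ContinuousAt (fun s => v (t - s)) 0 := by
        refine ContinuousAt.comp (g := v) ?_ (by fun_prop)
        simpa using hdv.continuousAt
      exact h1.inner h2.continuousWithinAt
    · exact (hd s h (by linarith [hs.2])).continuousAt.continuousWithinAt
  obtain ⟨s, hs, h⟩ := exists_hasDerivAt_eq_slope F (fun _ => 0) (show 0 < t / 2 by linarith) hc
    fun s hs => hd s hs.1 (by linarith [hs.2])
  have h2 : F (t / 2) - F 0 = 0 := by
    rcases div_eq_zero_iff.1 h.symm with h | h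
    · exact h
    · linarith
  have h3 : t - t / 2 = t / 2 := by ring
  simp only [hF, sub_zero, h3] at h2
  linarith

/-- Expand `‖u t - v t‖²`: each of the four products equals one of an initial value with a value at
time `2t`, and these cancel when the initial values agree. -/
lemma IsHeatSolution.unique {A : Set (H × H)}
    (hA : ∀ p ∈ A, ∀ r ∈ A, ⟪p.1, r.2⟫_ℝ = ⟪p.2, r.1⟫_ℝ) {u v : ℝ → H}
    (hu : IsHeatSolution A u) (hv : IsHeatSolution A v) (h0 : u 0 = v 0) {t : ℝ} (ht : 0 < t) :
    u t = v t := by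
  have h2t : 0 < 2 * t := by linarith
  have h1 := hu.inner_eq hA hu h2t
  have h2 := hu.inner_eq hA hv h2t
  have h3 := hv.inner_eq hA hu h2t
  have h4 := hv.inner_eq hA hv h2t
  rw [show 2 * t / 2 = t by ring] at h1 h2 h3 h4
  rw [← sub_eq_zero, ← inner_self_eq_zero (𝕜 := ℝ), inner_sub_left, inner_sub_right,
    inner_sub_right, ← h1, ← h2, ← h3, ← h4, h0]
  ring

end Hilbert

/-! ### Heat kernels of semibounded differential expressions -/

section HeatKernel

lemma continuous_mul_testFunction {E : Type*} [NormedAddCommGroup E] [NormedSpace ℝ E]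
    {Ω : Opens E} {F : E → ℝ} (hF : ContinuousOn F Ω) (f : 𝓓(Ω, ℝ)) :
    Continuous fun y => F y * f y := by
  refine continuous_of_tsupport fun y hy => ?_
  have hy' : y ∈ (Ω : Set E) := f.tsupport_subset (tsupport_mul_subset_right hy)
  exact (hF.continuousAt (Ω.2.mem_nhds hy')).mul f.continuous.continuousAt

variable {E : Type*} [NormedAddCommGroup E] [NormedSpace ℝ E] [MeasurableSpace E]

/-- The differential expression `L` is linear, symmetric and bounded below by `-c` on the smooth
functions compactly supported in `Ω`. -/
structure IsSemiboundedExpr (μ : Measure E) (Ω : Opens E) (L : (E → ℝ) → E → ℝ) (c : ℝ) :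
    Prop where
  add : ∀ φ ψ : 𝓓(Ω, ℝ), L (φ + ψ : 𝓓(Ω, ℝ)) =ᵐ[μ] L φ + L ψ
  smul : ∀ (a : ℝ) (φ : 𝓓(Ω, ℝ)), L (a • φ : 𝓓(Ω, ℝ)) =ᵐ[μ] a • L φ
  symm : ∀ φ ψ : 𝓓(Ω, ℝ), ∫ x, φ x * L ψ x ∂μ = ∫ x, L φ x * ψ x ∂μ
  bound : ∀ φ : 𝓓(Ω, ℝ), -c * ∫ x, φ x ^ 2 ∂μ ≤ ∫ x, φ x * L φ x ∂μ

lemma inner_eq_integral_of_ae_eq {α : Type*} [MeasurableSpace α] {μ : Measure α} {p q : Lp ℝ 2 μ}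
    {f g : α → ℝ} (hp : p =ᵐ[μ] f) (hq : q =ᵐ[μ] g) :
    ⟪p, q⟫_ℝ = ∫ x, f x * g x ∂μ := by
  rw [L2.inner_def]
  refine integral_congr_ae ?_
  filter_upwards [hp, hq] with x h1 h2
  rw [h1, h2]
  simp [mul_comm]

variable {μ : Measure E} {Ω : Opens E} {L : (E → ℝ) → E → ℝ} {c : ℝ}

/-- The graph of the minimal operator as a subspace. -/
def IsSemiboundedExpr.graph (hL : IsSemiboundedExpr μ Ω L c) :
    Submodule ℝ (Lp ℝ 2 μ × Lp ℝ 2 μ) where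
  carrier := minimalGraph μ Ω L
  add_mem' := by
    rintro p q ⟨φ, h1, h2⟩ ⟨ψ, h3, h4⟩
    refine ⟨φ + ψ, ?_, ?_⟩
    · filter_upwards [h1, h3, Lp.coeFn_add p.1 q.1] with x h1 h3 h
      exact h.trans (congrArg₂ (· + ·) h1 h3)
    · filter_upwards [h2, h4, Lp.coeFn_add p.2 q.2, hL.add φ ψ] with x h1 h3 h h5
      exact (h.trans (congrArg₂ (· + ·) h1 h3)).trans h5.symm
  zero_mem' := by
    refine ⟨0, ?_, ?_⟩
    · filter_upwards [Lp.coeFn_zero ℝ 2 μ] with x h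
      exact h
    · have h0 := hL.smul 0 0
      rw [smul_zero, zero_smul] at h0
      filter_upwards [Lp.coeFn_zero ℝ 2 μ, h0] with x h h'
      exact h.trans h'.symm
  smul_mem' := by
    rintro a p ⟨φ, h1, h2⟩
    refine ⟨a • φ, ?_, ?_⟩
    · filter_upwards [h1, Lp.coeFn_smul a p.1] with x h1 h
      exact h.trans (congrArg (a • ·) h1)
    · filter_upwards [h2, Lp.coeFn_smul a p.2, hL.smul a φ] with x h1 h h5
      exact (h.trans (congrArg (a • ·) h1)).trans h5.symm

lemma IsSemiboundedExpr.isSemibounded (hL : IsSemiboundedExpr μ Ω L c) :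
    IsSemibounded hL.graph c where
  symm := by
    rintro a ⟨φ, h1, h2⟩ b ⟨ψ, h3, h4⟩
    rw [inner_eq_integral_of_ae_eq h1 h4, inner_eq_integral_of_ae_eq h2 h3, hL.symm]
  bound := by
    rintro a ⟨φ, h1, h2⟩
    rw [← real_inner_self_eq_norm_sq, inner_eq_integral_of_ae_eq h1 h2,
      inner_eq_integral_of_ae_eq h1 h1]
    simpa only [pow_two] using hL.bound φ

lemma IsSemiboundedExpr.friedrichs_symm (hL : IsSemiboundedExpr μ Ω L c) :
    ∀ p ∈ friedrichs (minimalGraph μ Ω L), ∀ r ∈ friedrichs (minimalGraph μ Ω L),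
      ⟪p.1, r.2⟫_ℝ = ⟪p.2, r.1⟫_ℝ :=
  fun _ hp _ hr => hL.isSemibounded.friedrichs_symm hp hr

lemma IsHeatKernel.exists_solution {K : ℝ → E → E → ℝ} (hK : IsHeatKernel μ Ω L K)
    (f : 𝓓(Ω, ℝ)) : ∃ u : ℝ → Lp ℝ 2 μ, IsHeatSolution (friedrichs (minimalGraph μ Ω L)) u ∧
      (∀ t, 0 < t → u t =ᵐ[μ] fun x => ∫ y, K t x y * f y ∂μ) ∧ u 0 =ᵐ[μ] (f : E → ℝ) := by
  obtain ⟨u, h1, h2, h3, h4⟩ := hK.green f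
  exact ⟨u, ⟨h2, h4⟩, h1, h3⟩

lemma exists_testFunction_integral_eq_one [FiniteDimensional ℝ E] [BorelSpace E]
    [IsFiniteMeasureOnCompacts μ] (hμ : ∀ U : Set E, IsOpen U → U ⊆ Ω → U.Nonempty → 0 < μ U)
    {x : E} (hx : x ∈ Ω) {U : Set E} (hU : U ∈ 𝓝 x) :
    ∃ f : 𝓓(Ω, ℝ), (∀ y, 0 ≤ f y) ∧ tsupport f ⊆ U ∧ ∫ y, f y ∂μ = 1 := by
  obtain ⟨f, h1, h2, h3, h4, h5⟩ := exists_contDiff_tsupport_subset (n := ⊤)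
    (Filter.inter_mem hU (Ω.2.mem_nhds hx))
  have hsub : tsupport f ⊆ (Ω : Set E) := h1.trans inter_subset_right
  have hnn : ∀ y, 0 ≤ f y := fun y => (h4 (mem_range_self y)).1
  have hint : 0 < ∫ y, f y ∂μ := by
    rw [integral_pos_iff_support_of_nonneg hnn (h3.continuous.integrable_of_hasCompactSupport h2)]
    exact hμ _ (isOpen_ne_fun h3.continuous continuous_const)
      ((subset_tsupport f).trans hsub) ⟨x, by simp [h5]⟩
  refine ⟨(∫ y, f y ∂μ)⁻¹ • (⟨f, h3, h2, hsub⟩ : 𝓓(Ω, ℝ)), fun y => ?_, ?_, ?_⟩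
  · simpa using mul_nonneg (inv_nonneg.2 hint.le) (hnn y)
  · refine (closure_mono ?_).trans (h1.trans inter_subset_left)
    intro y hy hfy
    exact hy (by simp [hfy])
  · simp only [smul_apply, TestFunction.coe_mk, smul_eq_mul]
    rw [integral_const_mul, inv_mul_cancel₀ hint.ne']

lemma integrable_mul_testFunction [BorelSpace E] [IsFiniteMeasureOnCompacts μ] {F : E → ℝ}
    (hF : ContinuousOn F Ω) (f : 𝓓(Ω, ℝ)) : Integrable (fun y => F y * f y) μ :=
  (continuous_mul_testFunction hF f).integrable_of_hasCompactSupport f.hasCompactSupport.mul_left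

lemma IsHeatKernel.continuousOn_apply {K : ℝ → E → E → ℝ} (hK : IsHeatKernel μ Ω L K) {t : ℝ}
    (ht : 0 < t) {x : E} (hx : x ∈ Ω) : ContinuousOn (fun y => K t x y) Ω :=
  (hK.continuousOn t ht).comp (f := fun y => (x, y)) (by fun_prop) fun _ hy => ⟨hx, hy⟩

lemma IsHeatKernel.continuousOn_integral [BorelSpace E] [IsFiniteMeasureOnCompacts μ]
    {K : ℝ → E → E → ℝ} (hK : IsHeatKernel μ Ω L K) {t : ℝ} (ht : 0 < t) (f : 𝓓(Ω, ℝ)) :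
    ContinuousOn (fun x => ∫ y, K t x y * f y ∂μ) Ω := by
  refine continuousOn_integral_of_compact_support f.hasCompactSupport ?_
    fun x y _ hy => by rw [image_eq_zero_of_notMem_tsupport hy, mul_zero]
  rintro ⟨x, y⟩ ⟨hx, -⟩
  by_cases hy : y ∈ tsupport f
  · have h1 : (x, y) ∈ (Ω : Set E) ×ˢ (Ω : Set E) := ⟨hx, f.tsupport_subset hy⟩
    have h2 := (hK.continuousOn t ht).continuousAt ((Ω.2.prod Ω.2).mem_nhds h1)
    have h3 : ContinuousAt (fun p : E × E => f p.2) (x, y) :=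
      (f.continuous.comp continuous_snd).continuousAt
    exact (h2.mul h3).continuousWithinAt
  · have h1 : (fun p : E × E => K t p.1 p.2 * f p.2) =ᶠ[𝓝 (x, y)] fun _ => 0 := by
      have h2 : (tsupport f)ᶜ ∈ 𝓝 y := (isClosed_tsupport f).isOpen_compl.mem_nhds hy
      filter_upwards [continuous_snd.continuousAt.preimage_mem_nhds h2] with p hp
      rw [image_eq_zero_of_notMem_tsupport hp, mul_zero]
    exact (continuousAt_const.congr h1.symm).continuousWithinAt

lemma IsHeatKernel.abs_form_sub_le [BorelSpace E] [IsFiniteMeasureOnCompacts μ]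
    {K : ℝ → E → E → ℝ} (hK : IsHeatKernel μ Ω L K) {t : ℝ} (ht : 0 < t) {f g : 𝓓(Ω, ℝ)}
    (hf0 : ∀ y, 0 ≤ f y) (hg0 : ∀ y, 0 ≤ g y) (hf1 : ∫ y, f y ∂μ = 1) (hg1 : ∫ y, g y ∂μ = 1)
    {k ε : ℝ} (hk : ∀ x ∈ tsupport f, ∀ y ∈ tsupport g, |K t x y - k| ≤ ε) :
    |(∫ x, f x * ∫ y, K t x y * g y ∂μ ∂μ) - k| ≤ ε := by
  have hfi : Integrable f μ := f.continuous.integrable_of_hasCompactSupport f.hasCompactSupport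
  have hgi : Integrable g μ := g.continuous.integrable_of_hasCompactSupport g.hasCompactSupport
  have hinner : ∀ x ∈ tsupport f, |(∫ y, K t x y * g y ∂μ) - k| ≤ ε := by
    intro x hx
    have h1 : (∫ y, K t x y * g y ∂μ) - k = ∫ y, (K t x y * g y - k * g y) ∂μ := by
      rw [integral_sub (integrable_mul_testFunction
        (hK.continuousOn_apply ht (f.tsupport_subset hx)) g) (hgi.const_mul k),
        integral_const_mul, hg1, mul_one]
    rw [h1]
    rw [← mul_one ε, ← hg1, ← integral_const_mul, ← Real.norm_eq_abs]
    refine norm_integral_le_of_norm_le (hgi.const_mul ε) (ae_of_all _ fun y => ?_)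
    by_cases hy : y ∈ tsupport g
    · rw [← sub_mul, Real.norm_eq_abs, abs_mul, abs_of_nonneg (hg0 y)]
      exact mul_le_mul_of_nonneg_right (hk x hx y hy) (hg0 y)
    · simp [image_eq_zero_of_notMem_tsupport hy]
  have h2 : (∫ x, f x * ∫ y, K t x y * g y ∂μ ∂μ) - k
      = ∫ x, (f x * (∫ y, K t x y * g y ∂μ) - f x * k) ∂μ := by
    have h3 := integrable_mul_testFunction (μ := μ) (hK.continuousOn_integral ht g) f
    simp only [mul_comm _ (f _)] at h3
    rw [integral_sub h3 (hfi.mul_const k), integral_mul_const, hf1, one_mul]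
  rw [h2]
  rw [← mul_one ε, ← hf1, ← integral_const_mul, ← Real.norm_eq_abs]
  refine norm_integral_le_of_norm_le (hfi.const_mul ε) (ae_of_all _ fun x => ?_)
  by_cases hx : x ∈ tsupport f
  · rw [← mul_sub, Real.norm_eq_abs, abs_mul, abs_of_nonneg (hf0 x), mul_comm]
    exact mul_le_mul_of_nonneg_right (hinner x hx) (hf0 x)
  · simp [image_eq_zero_of_notMem_tsupport hx]

/-- Let `f`, `g` be probability densities concentrated near `x`, `y`, and `p`, `q` their evolutions
at time `t / 2`. The three kernel values are within `ε` of `⟪p, p⟫`, `⟪p, q⟫`, `⟪q, q⟫`, so they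
inherit the inequalities of a Gram matrix. -/
lemma IsHeatKernel.diag_bounds [FiniteDimensional ℝ E] [BorelSpace E]
    [IsFiniteMeasureOnCompacts μ] (hμ : ∀ U : Set E, IsOpen U → U ⊆ Ω → U.Nonempty → 0 < μ U)
    (hL : IsSemiboundedExpr μ Ω L c) {K : ℝ → E → E → ℝ} (hK : IsHeatKernel μ Ω L K) {t : ℝ}
    (ht : 0 < t) {x y : E} (hx : x ∈ Ω) (hy : y ∈ Ω) :
    0 ≤ K t x x ∧ 2 * |K t x y| ≤ K t x x + K t y y := by
  have key : ∀ ε : ℝ, 0 < ε → 0 ≤ K t x x + ε ∧ 2 * |K t x y| ≤ K t x x + K t y y + 4 * ε := by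
    intro ε hε
    have hnear : ∀ a ∈ Ω, ∀ b ∈ Ω, ∃ U ∈ 𝓝 a, ∃ W ∈ 𝓝 b, ∀ x ∈ U, ∀ y ∈ W,
        |K t x y - K t a b| ≤ ε := by
      intro a ha b hb
      have h1 : (a, b) ∈ (Ω : Set E) ×ˢ (Ω : Set E) := ⟨ha, hb⟩
      have h2 := (hK.continuousOn t ht).continuousAt ((Ω.2.prod Ω.2).mem_nhds h1)
      have h3 := h2.preimage_mem_nhds (Metric.closedBall_mem_nhds _ hε)
      rw [nhds_prod_eq, mem_prod_iff] at h3
      obtain ⟨U, hU, W, hW, h⟩ := h3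
      exact ⟨U, hU, W, hW, fun x hx y hy => h (mk_mem_prod hx hy)⟩
    obtain ⟨U1, hU1, W1, hW1, h1⟩ := hnear x hx x hx
    obtain ⟨U2, hU2, W2, hW2, h2⟩ := hnear x hx y hy
    obtain ⟨U3, hU3, W3, hW3, h3⟩ := hnear y hy y hy
    obtain ⟨f, hf0, hfs, hf1⟩ := exists_testFunction_integral_eq_one hμ hx
      (inter_mem (inter_mem hU1 hW1) hU2)
    obtain ⟨g, hg0, hgs, hg1⟩ := exists_testFunction_integral_eq_one hμ hy
      (inter_mem (inter_mem hU3 hW3) hW2)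
    have b1 := hK.abs_form_sub_le ht hf0 hf0 hf1 hf1 fun a ha b hb =>
      h1 a (hfs ha).1.1 b (hfs hb).1.2
    have b2 := hK.abs_form_sub_le ht hf0 hg0 hf1 hg1 fun a ha b hb =>
      h2 a (hfs ha).2 b (hgs hb).2
    have b3 := hK.abs_form_sub_le ht hg0 hg0 hg1 hg1 fun a ha b hb =>
      h3 a (hgs ha).1.1 b (hgs hb).1.2
    obtain ⟨u, hu, hut, hu0⟩ := hK.exists_solution f
    obtain ⟨v, hv, hvt, hv0⟩ := hK.exists_solution g
    rw [← inner_eq_integral_of_ae_eq hu0 (hut t ht), hu.inner_eq hL.friedrichs_symm hu ht] at b1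
    rw [← inner_eq_integral_of_ae_eq hu0 (hvt t ht), hu.inner_eq hL.friedrichs_symm hv ht] at b2
    rw [← inner_eq_integral_of_ae_eq hv0 (hvt t ht), hv.inner_eq hL.friedrichs_symm hv ht] at b3
    set p := u (t / 2)
    set q := v (t / 2)
    have h4 : 2 * |⟪p, q⟫_ℝ| ≤ ⟪p, p⟫_ℝ + ⟪q, q⟫_ℝ := by
      rw [real_inner_self_eq_norm_sq, real_inner_self_eq_norm_sq]
      nlinarith [abs_real_inner_le_norm p q, sq_nonneg (‖p‖ - ‖q‖)]
    have h5 : 0 ≤ ⟪p, p⟫_ℝ := real_inner_self_nonneg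
    rw [abs_le] at b1 b3
    have h6 : |K t x y| ≤ |⟪p, q⟫_ℝ| + ε := by
      rw [abs_sub_comm] at b2
      linarith [abs_sub_abs_le_abs_sub (K t x y) ⟪p, q⟫_ℝ]
    constructor <;> linarith
  constructor
  · exact le_of_forall_pos_le_add fun ε hε => (key ε hε).1
  · refine le_of_forall_pos_le_add fun ε hε => ?_
    have := (key (ε / 4) (by positivity)).2
    linarith

end HeatKernel

/-! ### Polar coordinates in `ℝ³` -/

section Polar

/-- The unit sphere of `ℝ³`. -/
abbrev Sph : Type := Metric.sphere (0 : E3) 1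

/-- The surface measure of the unit sphere. -/
abbrev surface : Measure Sph := (volume : Measure E3).toSphere

lemma norm_sph_coe (ξ : Sph) : ‖(ξ : E3)‖ = 1 := by simp

lemma measurePreserving_val_radialMeasure :
    MeasurePreserving (Subtype.val : Ioi (0 : ℝ) → ℝ) (Measure.volumeIoiPow 2) radialMeasure := by
  refine ⟨measurable_subtype_coe, ?_⟩
  ext s hs
  rw [Measure.map_apply measurable_subtype_coe hs, Measure.volumeIoiPow, radialMeasure,
    withDensity_apply _ (measurable_subtype_coe hs), withDensity_apply _ hs,
    setLIntegral_subtype measurableSet_Ioi _ fun a : ℝ => ENNReal.ofReal (a ^ 2),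
    Subtype.image_preimage_coe, Measure.restrict_restrict hs, inter_comm]

lemma measurePreserving_polar :
    MeasurePreserving (fun p : ℝ × Sph => p.1 • (p.2 : E3)) (radialMeasure.prod surface)
      volume := by
  have hm : Measurable (fun p : ℝ × Sph => p.1 • (p.2 : E3)) := by fun_prop
  refine ⟨hm, ?_⟩
  have h1 := (volume : Measure E3).measurePreserving_homeomorphUnitSphereProd
  have hd : Module.finrank ℝ E3 - 1 = 2 := by simp
  rw [hd] at h1
  have h2 : MeasurePreserving (homeomorphUnitSphereProd E3).symm.toMeasurableEquiv
      (surface.prod (Measure.volumeIoiPow 2)) ((volume : Measure E3).comap Subtype.val) :=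
    MeasurePreserving.symm (homeomorphUnitSphereProd E3).toMeasurableEquiv h1
  have h3 : Measure.map (Subtype.val : ({0}ᶜ : Set E3) → E3)
      ((volume : Measure E3).comap Subtype.val) = volume := by
    rw [map_comap_subtype_coe (measurableSet_singleton _).compl, restrict_compl_singleton]
  have h4 : radialMeasure.prod surface
      = Measure.map (Prod.map (Subtype.val : Ioi (0 : ℝ) → ℝ) (id : Sph → Sph))
        ((Measure.volumeIoiPow 2).prod surface) := by
    rw [← Measure.map_prod_map _ _ measurable_subtype_coe measurable_id, Measure.map_id,
      measurePreserving_val_radialMeasure.map_eq]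
  rw [h4, ← Measure.prod_swap, Measure.map_map (by fun_prop) measurable_swap,
    Measure.map_map hm (by fun_prop)]
  conv_rhs => rw [← h3]
  rw [← h2.map_eq, Measure.map_map measurable_subtype_coe h2.measurable]
  rfl

instance : SFinite radialMeasure := by unfold radialMeasure; infer_instance

instance : IsFiniteMeasureOnCompacts radialMeasure where
  lt_top_of_isCompact := by
    intro K hK
    obtain ⟨M, hM⟩ := hK.exists_bound_of_continuousOn (f := fun r : ℝ => r ^ 2) (by fun_prop)
    rw [radialMeasure, withDensity_apply _ hK.measurableSet]
    calc ∫⁻ r in K, ENNReal.ofReal (r ^ 2) ∂(volume.restrict (Ioi 0))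
        ≤ ∫⁻ r in K, ENNReal.ofReal M ∂(volume.restrict (Ioi 0)) := by
          refine setLIntegral_mono' hK.measurableSet fun r hr => ?_
          exact ENNReal.ofReal_le_ofReal ((le_abs_self _).trans (hM r hr))
      _ < ⊤ := by
          rw [setLIntegral_const]
          refine ENNReal.mul_lt_top ENNReal.ofReal_lt_top ?_
          exact lt_of_le_of_lt (Measure.restrict_apply_le _ _) hK.measure_lt_top

lemma radialMeasure_pos {U : Set ℝ} (hU : IsOpen U) (hU0 : U ⊆ Ioi 0) (hne : U.Nonempty) :
    0 < radialMeasure U := by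
  rw [pos_iff_ne_zero, radialMeasure, Ne, withDensity_apply_eq_zero (by fun_prop)]
  have h : {r : ℝ | ENNReal.ofReal (r ^ 2) ≠ 0} ∩ U = U := by
    refine inter_eq_right.2 fun r hr => ?_
    have : 0 < r := hU0 hr
    simp only [mem_ofPred_eq, ne_eq, ENNReal.ofReal_eq_zero, not_le]
    positivity
  rw [h, Measure.restrict_eq_self _ hU0]
  exact (hU.measure_pos volume hne).ne'

lemma ae_radialMeasure_pos : ∀ᵐ r ∂radialMeasure, 0 < r :=
  (withDensity_absolutelyContinuous _ _).ae_le (ae_restrict_mem measurableSet_Ioi)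

end Polar

/-! ### Zonal lifts and their Laplacian -/

section Lift

/-- The product of a radial function and the zonal harmonic of degree `l` about `n`. -/
def lift (n : E3) (l : ℕ) (f : ℝ → ℝ) (x : E3) : ℝ :=
  f ‖x‖ * (legendre l).eval (⟪n, x⟫_ℝ / ‖x‖)

lemma lift_smul (n : E3) (l : ℕ) (f : ℝ → ℝ) {r : ℝ} (hr : 0 < r) (ξ : Sph) :
    lift n l f (r • (ξ : E3)) = f r * (legendre l).eval ⟪n, ξ⟫_ℝ := by
  have h : ‖r • (ξ : E3)‖ = r := by
    rw [norm_smul, norm_sph_coe, mul_one, Real.norm_of_nonneg hr.le]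
  rw [lift, h, inner_smul_right, mul_div_cancel_left₀ _ hr.ne']

/-- Reduces the diagonal of the Hessian, hence the Laplacian, to one-variable calculus along lines.
-/
lemma iteratedFDeriv_two_eq_of_line {E : Type*} [NormedAddCommGroup E] [NormedSpace ℝ E]
    {F : E → ℝ} {x v : E} (hF : ContDiffAt ℝ 2 F x) {g : ℝ → ℝ} {d : ℝ}
    (hg : ∀ᶠ t in 𝓝 (0 : ℝ), HasDerivAt (fun t => F (x + t • v)) (g t) t)
    (hd : HasDerivAt g d 0) : iteratedFDeriv ℝ 2 F x ![v, v] = d := by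
  rw [iteratedFDeriv_two_apply]
  simp only [Matrix.cons_val_zero, Matrix.cons_val_one]
  have hline : ∀ t : ℝ, HasDerivAt (fun t : ℝ => x + t • v) v t := fun t => by
    simpa using ((hasDerivAt_id t).smul_const v).const_add x
  have h0 : x + (0 : ℝ) • v = x := by simp
  have hev : ∀ᶠ t in 𝓝 (0 : ℝ), DifferentiableAt ℝ F (x + t • v) := by
    have h1 : ∀ᶠ y in 𝓝 x, ContDiffAt ℝ 2 F y := hF.eventually (by simp)
    have h2 : Tendsto (fun t : ℝ => x + t • v) (𝓝 0) (𝓝 x) := by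
      have := (hline 0).continuousAt.tendsto
      rwa [h0] at this
    exact h2.eventually (h1.mono fun y hy => hy.differentiableAt (by norm_num))
  have heq : g =ᶠ[𝓝 0] fun t => fderiv ℝ F (x + t • v) v := by
    filter_upwards [hg, hev] with t h1 h2
    exact h1.unique (h2.hasFDerivAt.comp_hasDerivAt t (hline t))
  have h2 : HasFDerivAt (fderiv ℝ F) (fderiv ℝ (fderiv ℝ F) x) (x + (0 : ℝ) • v) := by
    rw [h0]
    exact ((hF.fderiv_right (m := 1) (by norm_num)).differentiableAt (by norm_num)).hasFDerivAt
  have h3 : HasDerivAt (fun t : ℝ => fderiv ℝ F (x + t • v)) (fderiv ℝ (fderiv ℝ F) x v) 0 :=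
    h2.comp_hasDerivAt (0 : ℝ) (hline 0)
  have h4 : HasDerivAt (fun t : ℝ => fderiv ℝ F (x + t • v) v) (fderiv ℝ (fderiv ℝ F) x v v) 0 := by
    have := ((ContinuousLinearMap.apply ℝ ℝ v).hasFDerivAt.comp_hasDerivAt (0 : ℝ) h3)
    exact this
  exact (h4.congr_of_eventuallyEq heq).unique hd

lemma contDiffAt_lift (n : E3) (l : ℕ) {f : ℝ → ℝ} {m : ℕ∞} (hf : ContDiff ℝ m f) {x : E3}
    (hx : x ≠ 0) : ContDiffAt ℝ m (lift n l f) x := by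
  have hn : ContDiffAt ℝ m (fun x : E3 => ‖x‖) x := contDiffAt_norm ℝ hx
  have h1 : ContDiffAt ℝ m (fun x : E3 => ⟪n, x⟫_ℝ / ‖x‖) x :=
    (contDiffAt_const.inner ℝ contDiffAt_id).div hn (norm_ne_zero_iff.2 hx)
  have h2 : ContDiff ℝ m (fun s : ℝ => (legendre l).eval s) := by
    simp only [← coe_aeval_eq_eval]
    exact (legendre l).contDiff_aeval m
  exact (hf.contDiffAt.comp x hn).mul (h2.contDiffAt.comp x h1)

lemma laplacian_lift {n : E3} (hn : ‖n‖ = 1) (l : ℕ) {f : ℝ → ℝ} (hf : ContDiff ℝ ∞ f) {x : E3}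
    (hx : x ≠ 0) :
    Laplacian.laplacian (lift n l f) x
      = lift n l (fun r => deriv (deriv f) r + 2 / r * deriv f r
          - (l : ℝ) * (l + 1) / r ^ 2 * f r) x := by
  have hF : ContDiffAt ℝ 2 (lift n l f) x := contDiffAt_lift n l (m := 2) (hf.of_le (by exact_mod_cast le_top)) hx
  have hf1 : ∀ r, HasDerivAt f (deriv f r) r := fun r =>
    (hf.differentiable (by simp)).differentiableAt.hasDerivAt
  have hf2 : ∀ r, HasDerivAt (deriv f) (deriv (deriv f) r) r := fun r =>
    ((contDiff_infty_iff_deriv.1 hf).2.differentiable (by simp)).differentiableAt.hasDerivAt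
  set P := legendre l with hP
  set u := ‖x‖ with hu
  have hu0 : u ≠ 0 := norm_ne_zero_iff.2 hx
  set b := ⟪n, x⟫_ℝ with hb
  set p0 := P.eval (b / u)
  set p1 := (derivative P).eval (b / u)
  set p2 := (derivative (derivative P)).eval (b / u)
  set f0 := f u
  set f1 := deriv f u
  set f2 := deriv (deriv f) u
  -- The squares are written as products `⟪x, v⟫ * ⟪v, x⟫` so that summation over an orthonormal
  -- basis is Parseval's identity.
  have key : ∀ v : E3, iteratedFDeriv ℝ 2 (lift n l f) x ![v, v]
      = (f2 * p0 / u ^ 2 - f1 * p0 / u ^ 3 - 2 * f1 * p1 * b / u ^ 4 + f0 * p2 * b ^ 2 / u ^ 6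
          + 3 * f0 * p1 * b / u ^ 5) * (⟪x, v⟫_ℝ * ⟪v, x⟫_ℝ)
        + f0 * p2 / u ^ 2 * (⟪n, v⟫_ℝ * ⟪v, n⟫_ℝ)
        + (2 * f1 * p1 / u ^ 2 - 2 * f0 * p2 * b / u ^ 4 - 2 * f0 * p1 / u ^ 3)
          * (⟪n, v⟫_ℝ * ⟪v, x⟫_ℝ)
        + (f1 * p0 / u - f0 * p1 * b / u ^ 3) * ⟪v, v⟫_ℝ := by
    intro v
    have hy : ∀ᶠ t in 𝓝 (0 : ℝ), x + t • v ≠ 0 := by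
      have : ContinuousAt (fun t : ℝ => x + t • v) 0 := by fun_prop
      exact this.eventually_ne (by simpa using hx)
    have hline : ∀ t : ℝ, HasDerivAt (fun t : ℝ => x + t • v) v t := fun t => by
      simpa using ((hasDerivAt_id t).smul_const v).const_add x
    have hU : ∀ t : ℝ, x + t • v ≠ 0 →
        HasDerivAt (fun t : ℝ => ‖x + t • v‖) (⟪x + t • v, v⟫_ℝ / ‖x + t • v‖) t := by
      intro t ht
      have h1 := ((hline t).norm_sq).sqrt (by simpa using ht)
      simp only [Real.sqrt_sq (norm_nonneg _)] at h1
      refine h1.congr_deriv ?_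
      have : ‖x + t • v‖ ≠ 0 := norm_ne_zero_iff.2 ht
      field_simp
    have hB : ∀ t : ℝ, HasDerivAt (fun t : ℝ => ⟪n, x + t • v⟫_ℝ) ⟪n, v⟫_ℝ t := fun t => by
      simpa using (hasDerivAt_const t n).inner ℝ (hline t)
    have hW : ∀ t : ℝ, HasDerivAt (fun t : ℝ => ⟪x + t • v, v⟫_ℝ) ⟪v, v⟫_ℝ t := fun t => by
      simpa using (hline t).inner ℝ (hasDerivAt_const t v)
    have hx0 : x + (0 : ℝ) • v ≠ 0 := by simpa using hx
    refine iteratedFDeriv_two_eq_of_line hF (g := fun t =>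
      deriv f ‖x + t • v‖ * (⟪x + t • v, v⟫_ℝ / ‖x + t • v‖)
          * P.eval (⟪n, x + t • v⟫_ℝ / ‖x + t • v‖)
        + f ‖x + t • v‖ * ((derivative P).eval (⟪n, x + t • v⟫_ℝ / ‖x + t • v‖)
          * ((⟪n, v⟫_ℝ * ‖x + t • v‖ - ⟪n, x + t • v⟫_ℝ * (⟪x + t • v, v⟫_ℝ / ‖x + t • v‖))
            / ‖x + t • v‖ ^ 2))) ?_ ?_
    · filter_upwards [hy] with t ht
      have ht' : ‖x + t • v‖ ≠ 0 := norm_ne_zero_iff.2 ht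
      have hS := (hB t).div (hU t ht) ht'
      exact ((hf1 _).comp t (hU t ht)).mul ((P.hasDerivAt _).comp t hS)
    · have ht' : ‖x + (0 : ℝ) • v‖ ≠ 0 := norm_ne_zero_iff.2 hx0
      have hU0 := hU 0 hx0
      have hS := (hB 0).div hU0 ht'
      have hU' := (hW 0).div hU0 ht'
      have h1 := (((hf2 _).comp (0 : ℝ) hU0).mul hU').mul ((P.hasDerivAt _).comp (0 : ℝ) hS)
      have h2 := ((hf1 _).comp (0 : ℝ) hU0).mul ((((derivative P).hasDerivAt _).comp (0 : ℝ) hS).mul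
        ((((hU0.const_mul ⟪n, v⟫_ℝ)).sub ((hB 0).mul hU')).div (hU0.pow 2) (pow_ne_zero 2 ht')))
      refine (h1.add h2).congr_deriv ?_
      simp only [Function.comp, Pi.mul_apply, Pi.div_apply, Pi.sub_apply, Pi.pow_apply, zero_smul,
        add_zero]
      simp only [real_inner_comm x v, real_inner_comm n v]
      simp only [← hu, ← hb]
      field_simp
      ring
  rw [InnerProductSpace.laplacian_eq_iteratedFDeriv_orthonormalBasis _
    (EuclideanSpace.basisFun (Fin 3) ℝ)]
  simp only [key]
  rw [Finset.sum_add_distrib, Finset.sum_add_distrib, Finset.sum_add_distrib, ← Finset.mul_sum,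
    ← Finset.mul_sum, ← Finset.mul_sum, ← Finset.mul_sum, OrthonormalBasis.sum_inner_mul_inner,
    OrthonormalBasis.sum_inner_mul_inner, OrthonormalBasis.sum_inner_mul_inner,
    real_inner_self_eq_norm_sq, real_inner_self_eq_norm_sq, hn, ← hb, ← hu]
  have hsum : ∑ i, ⟪EuclideanSpace.basisFun (Fin 3) ℝ i, EuclideanSpace.basisFun (Fin 3) ℝ i⟫_ℝ
      = 3 := by simp
  rw [hsum, lift, ← hu, ← hb]
  have ode := congrArg (eval (b / u)) (legendre_ode l)
  simp only [eval_add, eval_sub, eval_mul, eval_pow, eval_X, eval_one, eval_C, eval_zero,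
      eval_ofNat] at ode
  change (1 - (b / u) ^ 2) * p2 - 2 * (b / u) * p1 + (l : ℝ) * (l + 1) * p0 = 0 at ode
  change _ = (f2 + 2 / u * f1 - (l : ℝ) * (l + 1) / u ^ 2 * f0) * p0
  -- The Legendre equation turns the angular derivatives into the centrifugal term.
  have h2 : (l : ℝ) * (l + 1) * p0 = -((1 - (b / u) ^ 2) * p2 - 2 * (b / u) * p1) := by linarith
  have h3 : (f2 + 2 / u * f1 - (l : ℝ) * (l + 1) / u ^ 2 * f0) * p0
      = (f2 + 2 / u * f1) * p0 - f0 / u ^ 2 * ((l : ℝ) * (l + 1) * p0) := by ring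
  rw [h3, h2]
  field_simp
  ring

end Lift

/-! ### The lift as a multiple of an isometry of `L²` spaces -/

section LiftIntegrals

variable (n : E3) (l : ℕ)

/-- The component of `ψ` along the zonal harmonic of degree `l` about `n`. -/
def angular (ψ : E3 → ℝ) (r : ℝ) : ℝ :=
  ∫ ξ : Sph, (legendre l).eval ⟪n, ξ⟫_ℝ * ψ (r • (ξ : E3)) ∂surface

/-- The squared norm of the zonal harmonic of degree `l` about `n` on the sphere. -/
def zonalSq : ℝ := ∫ ξ : Sph, (legendre l).eval ⟪n, ξ⟫_ℝ * (legendre l).eval ⟪n, ξ⟫_ℝ ∂surface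

lemma continuous_zonal : Continuous fun ξ : Sph => (legendre l).eval ⟪n, ξ⟫_ℝ :=
  (legendre l).continuous.comp (by fun_prop)

lemma zonalSq_pos {n : E3} (hn : ‖n‖ = 1) (l : ℕ) : 0 < zonalSq n l := by
  have hc := (continuous_zonal n l).mul (continuous_zonal n l)
  refine hc.integral_pos_of_hasCompactSupport_nonneg_nonzero (HasCompactSupport.of_compactSpace _)
    (fun ξ => mul_self_nonneg _) (x := ⟨n, by simpa using hn⟩) ?_
  simp [hn, legendre_eval_one]

lemma ae_prod_pos : ∀ᵐ p ∂(radialMeasure.prod surface), 0 < p.1 :=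
  Measure.quasiMeasurePreserving_fst.ae ae_radialMeasure_pos

/-- Makes `lift` well defined on almost-everywhere classes and keeps it in `L²`. -/
lemma map_norm_volume :
    Measure.map (fun x : E3 => ‖x‖) volume = surface univ • radialMeasure := by
  rw [← measurePreserving_polar.map_eq, Measure.map_map measurable_norm
    measurePreserving_polar.measurable]
  have h : (fun x : E3 => ‖x‖) ∘ (fun p : ℝ × Sph => p.1 • (p.2 : E3))
      =ᵐ[radialMeasure.prod surface] Prod.fst := by
    filter_upwards [ae_prod_pos] with p hp
    simp [norm_smul, abs_of_pos hp]
  rw [Measure.map_congr h, Measure.map_fst_prod]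

lemma quasiMeasurePreserving_norm :
    Measure.QuasiMeasurePreserving (fun x : E3 => ‖x‖) volume radialMeasure :=
  ⟨measurable_norm, by rw [map_norm_volume]; exact Measure.smul_absolutelyContinuous⟩

lemma measurable_zonal_div :
    Measurable fun x : E3 => (legendre l).eval (⟪n, x⟫_ℝ / ‖x‖) :=
  (legendre l).continuous.measurable.comp (by fun_prop)

lemma lift_congr_ae {f g : ℝ → ℝ} (h : f =ᵐ[radialMeasure] g) :
    lift n l f =ᵐ[volume] lift n l g := by
  filter_upwards [quasiMeasurePreserving_norm.ae h] with x hx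
  simp only [lift, hx]

lemma inner_div_norm_mem {n : E3} (hn : ‖n‖ = 1) (x : E3) : ⟪n, x⟫_ℝ / ‖x‖ ∈ Icc (-1 : ℝ) 1 := by
  have h := abs_real_inner_div_norm_mul_norm_le_one n x
  rw [hn, one_mul] at h
  exact abs_le.1 h

lemma memLp_lift {n : E3} (hn : ‖n‖ = 1) {f : ℝ → ℝ} (hf : MemLp f 2 radialMeasure) :
    MemLp (lift n l f) 2 volume := by
  have h1 : MemLp (fun x : E3 => f ‖x‖) 2 volume := by
    refine MemLp.comp_of_map (f := fun x : E3 => ‖x‖) (g := f) ?_ measurable_norm.aemeasurable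
    rw [map_norm_volume]
    exact hf.smul_measure (measure_ne_top _ _)
  refine h1.mono (h1.1.mul (measurable_zonal_div n l).aestronglyMeasurable)
    (ae_of_all _ fun x => ?_)
  rw [lift, norm_mul]
  exact mul_le_of_le_one_right (norm_nonneg _) (abs_legendre_eval_le l (inner_div_norm_mem hn x))

lemma integral_eq_polar {F : E3 → ℝ} (hF : Integrable F volume) :
    ∫ x, F x = ∫ r, ∫ ξ : Sph, F (r • (ξ : E3)) ∂surface ∂radialMeasure := by
  rw [← measurePreserving_polar.map_eq] at hF
  have h : ∫ x, F x = ∫ p, F (p.1 • (p.2 : E3)) ∂(radialMeasure.prod surface) := by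
    conv_lhs => rw [← measurePreserving_polar.map_eq]
    exact integral_map measurePreserving_polar.measurable.aemeasurable hF.1
  rw [h]
  exact integral_prod _ ((integrable_map_measure hF.1
    measurePreserving_polar.measurable.aemeasurable).1 hF)

/-- `angular n l` is the formal adjoint of `lift n l`. -/
lemma integral_lift_mul {f : ℝ → ℝ} {ψ : E3 → ℝ}
    (h : Integrable (fun x => lift n l f x * ψ x) volume) :
    ∫ x, lift n l f x * ψ x = ∫ r, f r * angular n l ψ r ∂radialMeasure := by
  rw [integral_eq_polar h]
  refine integral_congr_ae ?_
  filter_upwards [ae_radialMeasure_pos] with r hr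
  simp only [lift_smul n l f hr, angular, mul_assoc]
  rw [integral_const_mul]

lemma angular_lift (f : ℝ → ℝ) {r : ℝ} (hr : 0 < r) :
    angular n l (lift n l f) r = zonalSq n l * f r := by
  simp only [angular, zonalSq, lift_smul n l f hr]
  rw [← integral_mul_const]
  congr 1 with ξ
  ring

lemma integral_lift_mul_lift {n : E3} (hn : ‖n‖ = 1) {f g : ℝ → ℝ}
    (hf : MemLp f 2 radialMeasure) (hg : MemLp g 2 radialMeasure) :
    ∫ x, lift n l f x * lift n l g x = zonalSq n l * ∫ r, f r * g r ∂radialMeasure := by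
  rw [integral_lift_mul n l ((memLp_lift l hn hf).integrable_mul (memLp_lift l hn hg)),
    ← integral_const_mul]
  refine integral_congr_ae ?_
  filter_upwards [ae_radialMeasure_pos] with r hr
  simp only [angular_lift n l g hr]
  ring

/-- `lift` as a bounded operator `L²((0, ∞), r² dr) → L²(ℝ³)`. -/
def liftL2 {n : E3} (hn : ‖n‖ = 1) (l : ℕ) : Lp ℝ 2 radialMeasure →L[ℝ] Lp ℝ 2 (volume : Measure E3) :=
  LinearMap.mkContinuous
    { toFun := fun R => (memLp_lift l hn (Lp.memLp R)).toLp
      map_add' := fun R S => by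
        rw [← MemLp.toLp_add]
        refine (MemLp.toLp_eq_toLp_iff _ _).2 ?_
        filter_upwards [lift_congr_ae n l (Lp.coeFn_add R S)] with x hx
        rw [hx]
        simp only [lift, Pi.add_apply]
        ring
      map_smul' := fun a R => by
        rw [RingHom.id_apply, ← MemLp.toLp_const_smul]
        refine (MemLp.toLp_eq_toLp_iff _ _).2 ?_
        filter_upwards [lift_congr_ae n l (Lp.coeFn_smul a R)] with x hx
        rw [hx]
        simp only [lift, Pi.smul_apply, smul_eq_mul]
        ring }
    (Real.sqrt (zonalSq n l)) fun R => by
      have h1 := (memLp_lift l hn (Lp.memLp R)).coeFn_toLp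
      have h := integral_lift_mul_lift l hn (Lp.memLp R) (Lp.memLp R)
      rw [← inner_eq_integral_of_ae_eq h1 h1,
        ← inner_eq_integral_of_ae_eq (ae_eq_refl R) (ae_eq_refl R), real_inner_self_eq_norm_sq,
        real_inner_self_eq_norm_sq] at h
      refine le_of_sq_le_sq ?_ (by positivity)
      rw [mul_pow, Real.sq_sqrt (zonalSq_pos hn l).le]
      exact h.le

lemma coeFn_liftL2 {n : E3} (hn : ‖n‖ = 1) (R : Lp ℝ 2 radialMeasure) :
    liftL2 hn l R =ᵐ[volume] lift n l R :=
  (memLp_lift l hn (Lp.memLp R)).coeFn_toLp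

lemma coeFn_liftL2_of_ae_eq {n : E3} (hn : ‖n‖ = 1) {R : Lp ℝ 2 radialMeasure} {f : ℝ → ℝ}
    (h : R =ᵐ[radialMeasure] f) : liftL2 hn l R =ᵐ[volume] lift n l f :=
  (coeFn_liftL2 l hn R).trans (lift_congr_ae n l h)

lemma inner_liftL2 {n : E3} (hn : ‖n‖ = 1) (R S : Lp ℝ 2 radialMeasure) :
    ⟪liftL2 hn l R, liftL2 hn l S⟫_ℝ = zonalSq n l * ⟪R, S⟫_ℝ := by
  rw [inner_eq_integral_of_ae_eq (coeFn_liftL2 l hn R) (coeFn_liftL2 l hn S),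
    integral_lift_mul_lift l hn (Lp.memLp R) (Lp.memLp S),
    ← inner_eq_integral_of_ae_eq (ae_eq_refl R) (ae_eq_refl S)]

end LiftIntegrals

/-! ### Test functions on the half-line and the radial operator on them -/

section TestFunctions

lemma zero_notMem_tsupport (f : 𝓓(halfLine, ℝ)) : (0 : ℝ) ∉ tsupport f := fun h =>
  lt_irrefl (0 : ℝ) (f.tsupport_subset h)

/-- The lift of a radial test function. -/
def liftTest (n : E3) (l : ℕ) (f : 𝓓(halfLine, ℝ)) : 𝓓(punctured, ℝ) :=
  have hzero : ∀ x : E3, ‖x‖ ∉ tsupport f → lift n l f x = 0 := fun x hx => by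
    rw [lift, image_eq_zero_of_notMem_tsupport hx, zero_mul]
  have hclosed : IsClosed {x : E3 | ‖x‖ ∈ tsupport f} :=
    (isClosed_tsupport f).preimage continuous_norm
  have hsub : tsupport (lift n l f) ⊆ {x : E3 | ‖x‖ ∈ tsupport f} :=
    closure_minimal (fun x hx => by_contra fun h => hx (hzero x h)) hclosed
  { toFun := lift n l f
    contDiff' := by
      refine contDiff_iff_contDiffAt.2 fun x => ?_
      by_cases hx : x = 0
      · have h0 : x ∉ {x : E3 | ‖x‖ ∈ tsupport f} := by
          subst hx
          simpa using zero_notMem_tsupport f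
        have h1 : lift n l f =ᶠ[𝓝 x] fun _ => 0 := by
          filter_upwards [hclosed.isOpen_compl.mem_nhds h0] with y hy
          exact hzero y hy
        exact contDiffAt_const.congr_of_eventuallyEq h1
      · exact contDiffAt_lift n l f.contDiff hx
    hasCompactSupport' := by
      refine (Metric.isCompact_of_isClosed_isBounded (isClosed_tsupport _) ?_)
      obtain ⟨M, hM⟩ := f.hasCompactSupport.isBounded.exists_norm_le
      refine isBounded_iff_forall_norm_le.2 ⟨M, fun x hx => ?_⟩
      simpa using hM _ (hsub hx)
    tsupport_subset' := fun x hx => by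
      have h := hsub hx
      change x ≠ 0
      rintro rfl
      exact zero_notMem_tsupport f (by simpa using h) }

@[simp]
lemma coe_liftTest (n : E3) (l : ℕ) (f : 𝓓(halfLine, ℝ)) : ⇑(liftTest n l f) = lift n l f := rfl

/-- The derivative of a test function on the half-line. -/
def derivTest (f : 𝓓(halfLine, ℝ)) : 𝓓(halfLine, ℝ) where
  toFun := deriv f
  contDiff' := (contDiff_infty_iff_deriv.1 f.contDiff).2
  hasCompactSupport' := f.hasCompactSupport.deriv
  tsupport_subset' := tsupport_deriv_subset.trans f.tsupport_subset

@[simp]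
lemma coe_derivTest (f : 𝓓(halfLine, ℝ)) : ⇑(derivTest f) = deriv f := rfl

lemma hasDerivAt_testFunction (f : 𝓓(halfLine, ℝ)) (r : ℝ) : HasDerivAt f (deriv f r) r :=
  (f.contDiff.differentiable (by simp)).differentiableAt.hasDerivAt

lemma radialOp_eq (V : ℝ → ℝ) (l : ℕ) (f : 𝓓(halfLine, ℝ)) {r : ℝ} (hr : 0 < r) :
    radialOp V l f r = -(deriv (deriv f) r + 2 / r * deriv f r - (l : ℝ) * (l + 1) / r ^ 2 * f r)
      + V r * f r := by
  have h := ((hasDerivAt_id r).pow 2).mul (hasDerivAt_testFunction (derivTest f) r)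
  have h2 : deriv (fun s => s ^ 2 * deriv f s) r = _ := h.deriv
  rw [radialOp, h2]
  simp
  field_simp
  ring

lemma fullOp_lift (V : ℝ → ℝ) {n : E3} (hn : ‖n‖ = 1) (l : ℕ) (f : 𝓓(halfLine, ℝ)) {x : E3}
    (hx : x ≠ 0) : fullOp V (lift n l f) x = lift n l (radialOp V l f) x := by
  rw [fullOp, laplacian_lift hn l f.contDiff hx]
  simp only [lift, radialOp_eq V l f (norm_pos_iff.2 hx)]
  ring

lemma exists_tsupport_subset_Icc (f : 𝓓(halfLine, ℝ)) :
    ∃ a b : ℝ, 0 < a ∧ a < b ∧ tsupport f ⊆ Icc a b := by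
  have hK : IsCompact (tsupport f) := f.hasCompactSupport
  have hpos : ∀ r ∈ tsupport f, 0 < r := fun r hr => f.tsupport_subset hr
  obtain ⟨A, hA⟩ := hK.exists_bound_of_continuousOn (f := fun r : ℝ => r⁻¹)
    (continuousOn_inv₀.mono fun r hr => (hpos r hr).ne')
  obtain ⟨B, hB⟩ := hK.exists_bound_of_continuousOn (f := fun r : ℝ => r) (by fun_prop)
  have h1 : 0 < |A| + 1 := by positivity
  refine ⟨(|A| + 1)⁻¹, |B| + 2, by positivity, ?_, fun r hr => ⟨?_, ?_⟩⟩
  · have : (|A| + 1)⁻¹ ≤ 1 := inv_le_one_of_one_le₀ (by linarith [abs_nonneg A])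
    linarith [abs_nonneg B]
  · have h2 := hA r hr
    rw [Real.norm_of_nonneg (inv_nonneg.2 (hpos r hr).le)] at h2
    exact inv_le_of_inv_le₀ (hpos r hr) (by linarith [le_abs_self A])
  · have h2 := hB r hr
    rw [Real.norm_of_nonneg (hpos r hr).le] at h2
    linarith [le_abs_self B]

lemma memLp_testFunction (f : 𝓓(halfLine, ℝ)) : MemLp f 2 radialMeasure :=
  f.continuous.memLp_of_hasCompactSupport f.hasCompactSupport

lemma memLp_mul_testFunction {F : ℝ → ℝ} (hF : ContinuousOn F (Ioi 0)) (f : 𝓓(halfLine, ℝ)) :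
    MemLp (fun r => F r * f r) 2 radialMeasure :=
  (continuous_mul_testFunction (Ω := halfLine) hF f).memLp_of_hasCompactSupport
    f.hasCompactSupport.mul_left

lemma radialMeasure_restrict_Icc_le (a b : ℝ) :
    radialMeasure.restrict (Icc a b) ≤
      ENNReal.ofReal (max (a ^ 2) (b ^ 2)) • volume.restrict (Icc a b) := by
  refine Measure.le_iff.2 fun s hs => ?_
  rw [Measure.restrict_apply hs, radialMeasure,
    withDensity_apply _ (hs.inter measurableSet_Icc)]
  calc ∫⁻ r in s ∩ Icc a b, ENNReal.ofReal (r ^ 2) ∂(volume.restrict (Ioi 0))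
      ≤ ∫⁻ r in s ∩ Icc a b, ENNReal.ofReal (max (a ^ 2) (b ^ 2)) ∂(volume.restrict (Ioi 0)) := by
        refine setLIntegral_mono' (hs.inter measurableSet_Icc) fun r hr => ?_
        refine ENNReal.ofReal_le_ofReal ?_
        rcases le_total 0 r with h | h
        · exact le_max_of_le_right (pow_le_pow_left₀ h hr.2.2 2)
        · exact le_max_of_le_left (by nlinarith [hr.2.1])
    _ ≤ _ := by
        rw [setLIntegral_const, Measure.smul_apply, smul_eq_mul, Measure.restrict_apply hs]
        gcongr
        exact Measure.restrict_le_self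

lemma memLp_radialOp {V : ℝ → ℝ}
    (hV : ∀ a b : ℝ, 0 < a → a < b → MemLp V 2 (volume.restrict (Icc a b))) (l : ℕ)
    (f : 𝓓(halfLine, ℝ)) : MemLp (radialOp V l f) 2 radialMeasure := by
  obtain ⟨a, b, ha, hab, hf⟩ := exists_tsupport_subset_Icc f
  have h1 : MemLp (fun r => V r * f r) 2 radialMeasure := by
    have h2 : (fun r => V r * f r) = (Icc a b).indicator fun r => V r * f r := by
      refine (indicator_eq_self.2 fun r hr => hf (subset_tsupport f fun h => hr ?_)).symm
      simp [h]
    obtain ⟨M, hM⟩ := f.hasCompactSupport.exists_bound_of_continuous f.continuous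
    rw [h2, memLp_indicator_iff_restrict measurableSet_Icc]
    refine MemLp.of_measure_le_smul ENNReal.ofReal_ne_top (radialMeasure_restrict_Icc_le a b) ?_
    refine (hV a b ha hab).of_le_mul (c := M)
      ((hV a b ha hab).1.mul f.continuous.aestronglyMeasurable) (ae_of_all _ fun r => ?_)
    rw [norm_mul, mul_comm]
    exact mul_le_mul_of_nonneg_right (hM r) (norm_nonneg _)
  have h3 : MemLp (fun r => 2 / r * deriv f r) 2 radialMeasure :=
    memLp_mul_testFunction (F := fun r => 2 / r)
      (continuousOn_const.div continuousOn_id fun r hr => (ne_of_gt hr)) (derivTest f)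
  have h4 : MemLp (fun r => (l : ℝ) * (l + 1) / r ^ 2 * f r) 2 radialMeasure :=
    memLp_mul_testFunction (F := fun r => (l : ℝ) * (l + 1) / r ^ 2)
      (continuousOn_const.div (by fun_prop) fun r hr => pow_ne_zero 2 (ne_of_gt hr)) f
  have h5 : MemLp (deriv (deriv f)) 2 radialMeasure := memLp_testFunction (derivTest (derivTest f))
  refine ((((h5.add h3).sub h4).neg).add h1).ae_eq ?_
  filter_upwards [ae_radialMeasure_pos] with r hr
  rw [radialOp_eq V l f hr]
  rfl

end TestFunctions

/-! ### Symmetry and semiboundedness of `D` and `D_l` -/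

section Operators

lemma two_le_infty : (2 : WithTop ℕ∞) ≤ ((⊤ : ℕ∞) : WithTop ℕ∞) := by
  have h : ((2 : ℕ∞) : WithTop ℕ∞) ≤ ((⊤ : ℕ∞) : WithTop ℕ∞) := by exact_mod_cast le_top
  exact h

lemma fullOp_add (V : ℝ → ℝ) (φ ψ : 𝓓(punctured, ℝ)) :
    fullOp V (φ + ψ : 𝓓(punctured, ℝ)) = fullOp V φ + fullOp V ψ := by
  ext x
  have h := ContDiffAt.laplacian_add (φ.contDiff.contDiffAt (x := x).of_le two_le_infty)
    (ψ.contDiff.contDiffAt (x := x).of_le two_le_infty)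
  have h2 : ((φ + ψ : 𝓓(punctured, ℝ)) : E3 → ℝ) = φ + ψ := rfl
  simp only [fullOp, h2, Pi.add_apply]
  rw [h]
  ring

lemma fullOp_smul (V : ℝ → ℝ) (a : ℝ) (φ : 𝓓(punctured, ℝ)) :
    fullOp V (a • φ : 𝓓(punctured, ℝ)) = a • fullOp V φ := by
  ext x
  have h := InnerProductSpace.laplacian_smul a
    (φ.contDiff.contDiffAt (x := x).of_le two_le_infty)
  have h2 : ((a • φ : 𝓓(punctured, ℝ)) : E3 → ℝ) = a • φ := rfl
  simp only [fullOp, h2, Pi.smul_apply, smul_eq_mul]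
  rw [h, smul_eq_mul]
  ring

lemma continuous_laplacian_testFunction (φ : 𝓓(punctured, ℝ)) :
    Continuous (Laplacian.laplacian (φ : E3 → ℝ)) := by
  have h : Laplacian.laplacian (φ : E3 → ℝ)
      = ⇑(Laplacian.laplacian (φ.hasCompactSupport.toSchwartzMap φ.contDiff)) := by
    ext x
    rw [SchwartzMap.laplacian_apply]
    rfl
  rw [h]
  exact SchwartzMap.continuous _

lemma integral_laplacian_symm (φ ψ : 𝓓(punctured, ℝ)) :
    ∫ x, φ x * Laplacian.laplacian (ψ : E3 → ℝ) x = ∫ x, Laplacian.laplacian (φ : E3 → ℝ) x * ψ x := by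
  have h := SchwartzMap.integral_mul_laplacian_right_eq_left (μ := volume)
    (φ.hasCompactSupport.toSchwartzMap φ.contDiff) (ψ.hasCompactSupport.toSchwartzMap ψ.contDiff)
  simp only [SchwartzMap.laplacian_apply] at h
  exact h

lemma integrable_mul_laplacian (φ ψ : 𝓓(punctured, ℝ)) :
    Integrable (fun x => φ x * Laplacian.laplacian (ψ : E3 → ℝ) x) :=
  (φ.continuous.mul (continuous_laplacian_testFunction ψ)).integrable_of_hasCompactSupport
    φ.hasCompactSupport.mul_right

lemma integral_fullOp_symm (V : ℝ → ℝ) (φ ψ : 𝓓(punctured, ℝ)) :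
    ∫ x, φ x * fullOp V ψ x = ∫ x, fullOp V φ x * ψ x := by
  have h1 := integrable_mul_laplacian φ ψ
  have h2 : Integrable fun x => Laplacian.laplacian (φ : E3 → ℝ) x * ψ x := by
    simpa only [mul_comm] using integrable_mul_laplacian ψ φ
  have h3 : (fun x => φ x * fullOp V ψ x)
      = fun x => fullOp V φ x * ψ x - (φ x * Laplacian.laplacian (ψ : E3 → ℝ) x
        - Laplacian.laplacian (φ : E3 → ℝ) x * ψ x) := by
    ext x
    simp only [fullOp]
    ring
  have h0 : ∫ x, (φ x * Laplacian.laplacian (ψ : E3 → ℝ) x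
      - Laplacian.laplacian (φ : E3 → ℝ) x * ψ x) = 0 := by
    rw [integral_sub h1 h2, integral_laplacian_symm, sub_self]
  rw [h3]
  -- The two integrands differ by an integrable function of integral zero. If one is not integrable,
  -- neither is the other, and both integrals take the default value `0`.
  by_cases h : Integrable fun x => fullOp V φ x * ψ x
  · have h4 : Integrable fun x => φ x * Laplacian.laplacian (ψ : E3 → ℝ) x
        - Laplacian.laplacian (φ : E3 → ℝ) x * ψ x := h1.sub h2
    rw [integral_sub h h4, h0, sub_zero]
  · rw [integral_undef h, integral_undef]
    intro h4
    apply h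
    refine (h4.add (h1.sub h2)).congr (ae_of_all _ fun x => ?_)
    simp

lemma isSemiboundedExpr_fullOp {V : ℝ → ℝ} {c : ℝ} (hc : ∀ ψ : 𝓓(punctured, ℝ),
      -c * ∫ x, ψ x ^ 2 ≤ ∫ x, ψ x * fullOp V ψ x) :
    IsSemiboundedExpr volume punctured (fullOp V) c where
  add φ ψ := by rw [fullOp_add]
  smul a φ := by rw [fullOp_smul]
  symm := integral_fullOp_symm V
  bound := hc

lemma fullOp_lift_ae (V : ℝ → ℝ) {n : E3} (hn : ‖n‖ = 1) (l : ℕ) (f : 𝓓(halfLine, ℝ)) :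
    fullOp V (lift n l f) =ᵐ[volume] lift n l (radialOp V l f) := by
  filter_upwards [compl_mem_ae_iff.2 (measure_singleton (0 : E3))] with x hx
  exact fullOp_lift V hn l f hx

/-- Through this identity `D_l` inherits symmetry and the same lower bound `-c` from `D`. -/
lemma zonalSq_mul_integral_radialOp {V : ℝ → ℝ}
    (hV : ∀ a b : ℝ, 0 < a → a < b → MemLp V 2 (volume.restrict (Icc a b)))
    {n : E3} (hn : ‖n‖ = 1) (l : ℕ) (f g : 𝓓(halfLine, ℝ)) :
    zonalSq n l * ∫ r, f r * radialOp V l g r ∂radialMeasure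
      = ∫ x, liftTest n l f x * fullOp V (liftTest n l g) x := by
  rw [← integral_lift_mul_lift l hn (memLp_testFunction f) (memLp_radialOp hV l g)]
  refine integral_congr_ae ?_
  filter_upwards [fullOp_lift_ae V hn l g] with x hx
  rw [coe_liftTest, coe_liftTest, hx]

lemma exists_unit : ∃ n : E3, ‖n‖ = 1 := ⟨EuclideanSpace.single 2 1, by simp⟩

lemma integral_radialOp_symm {V : ℝ → ℝ}
    (hV : ∀ a b : ℝ, 0 < a → a < b → MemLp V 2 (volume.restrict (Icc a b)))
    (l : ℕ) (f g : 𝓓(halfLine, ℝ)) :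
    ∫ r, f r * radialOp V l g r ∂radialMeasure = ∫ r, radialOp V l f r * g r ∂radialMeasure := by
  obtain ⟨n, hn⟩ := exists_unit
  apply mul_left_cancel₀ (zonalSq_pos hn l).ne'
  simp_rw [mul_comm (radialOp V l f _)]
  rw [zonalSq_mul_integral_radialOp hV hn, zonalSq_mul_integral_radialOp hV hn,
    integral_fullOp_symm]
  simp_rw [mul_comm (fullOp V _ _)]

lemma isSemiboundedExpr_radialOp {V : ℝ → ℝ}
    (hV : ∀ a b : ℝ, 0 < a → a < b → MemLp V 2 (volume.restrict (Icc a b)))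
    {c : ℝ} (hc : ∀ ψ : 𝓓(punctured, ℝ),
      -c * ∫ x, ψ x ^ 2 ≤ ∫ x, ψ x * fullOp V ψ x) (l : ℕ) :
    IsSemiboundedExpr radialMeasure halfLine (radialOp V l) c where
  add φ ψ := by
    have h1 : deriv (φ + ψ : 𝓓(halfLine, ℝ)) = deriv φ + deriv ψ := by
      ext r
      exact ((hasDerivAt_testFunction φ r).add (hasDerivAt_testFunction ψ r)).deriv
    filter_upwards [ae_radialMeasure_pos] with r hr
    have h2 : deriv (deriv φ + deriv ψ) r = deriv (deriv φ) r + deriv (deriv ψ) r :=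
      ((hasDerivAt_testFunction (derivTest φ) r).add
        (hasDerivAt_testFunction (derivTest ψ) r)).deriv
    have h3 : (φ + ψ : 𝓓(halfLine, ℝ)) r = φ r + ψ r := rfl
    rw [Pi.add_apply, radialOp_eq V l _ hr, radialOp_eq V l _ hr, radialOp_eq V l _ hr, h1, h2, h3,
      Pi.add_apply]
    ring
  smul a φ := by
    have h1 : deriv (a • φ : 𝓓(halfLine, ℝ)) = a • deriv φ := by
      ext r
      exact ((hasDerivAt_testFunction φ r).const_smul a).deriv
    filter_upwards [ae_radialMeasure_pos] with r hr
    have h2 : deriv (a • deriv φ) r = a * deriv (deriv φ) r :=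
      ((hasDerivAt_testFunction (derivTest φ) r).const_smul a).deriv
    have h3 : (a • φ : 𝓓(halfLine, ℝ)) r = a * φ r := rfl
    rw [Pi.smul_apply, radialOp_eq V l _ hr, radialOp_eq V l _ hr, h1, h2, h3,
      Pi.smul_apply, smul_eq_mul, smul_eq_mul]
    ring
  symm := integral_radialOp_symm hV l
  bound φ := by
    obtain ⟨n, hn⟩ := exists_unit
    refine le_of_mul_le_mul_left ?_ (zonalSq_pos hn l)
    rw [zonalSq_mul_integral_radialOp hV hn]
    refine le_trans (le_of_eq ?_) (hc (liftTest n l φ))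
    simp only [pow_two, coe_liftTest]
    rw [integral_lift_mul_lift l hn (memLp_testFunction φ) (memLp_testFunction φ)]
    ring

end Operators

/-! ### Angular projection of test functions on `ℝ³ \ {0}` -/

section Angular

/-- With an arbitrary continuous weight the derivative is a sum of integrals of the same kind, with
weights `w ξ * ξ i`, so smoothness follows by induction. -/
lemma hasDerivAt_angularIntegral {w : Sph → ℝ} (hw : Continuous w) {ψ : E3 → ℝ}
    (hψ : ContDiff ℝ 1 ψ) (r₀ : ℝ) :
    HasDerivAt (fun r : ℝ => ∫ ξ : Sph, w ξ * ψ (r • (ξ : E3)) ∂surface)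
      (∑ i, ∫ ξ : Sph, (w ξ * (ξ : E3) i) *
        fderiv ℝ ψ (r₀ • (ξ : E3)) (EuclideanSpace.basisFun (Fin 3) ℝ i) ∂surface) r₀ := by
  have hfd : Continuous (fderiv ℝ ψ) := hψ.continuous_fderiv (by norm_num)
  have hψc := hψ.continuous
  have hsmul : Continuous fun p : ℝ × Sph => p.1 • (p.2 : E3) := by fun_prop
  have hF' : Continuous fun p : ℝ × Sph => w p.2 * fderiv ℝ ψ (p.1 • (p.2 : E3)) p.2 :=
    (hw.comp continuous_snd).mul
      ((hfd.comp hsmul).clm_apply (continuous_subtype_val.comp continuous_snd))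
  obtain ⟨M, hM⟩ := ((isCompact_closedBall r₀ 1).prod (isCompact_univ (X := Sph))).exists_bound_of_continuousOn
    hF'.continuousOn
  have hint : ∀ {g : Sph → ℝ}, Continuous g → Integrable g surface := fun hg =>
    hg.integrable_of_hasCompactSupport (HasCompactSupport.of_compactSpace _)
  have h := hasDerivAt_integral_of_dominated_loc_of_deriv_le (μ := surface)
    (F := fun r ξ => w ξ * ψ (r • (ξ : E3)))
    (F' := fun r ξ => w ξ * fderiv ℝ ψ (r • (ξ : E3)) ξ) (bound := fun _ => M) (x₀ := r₀)
    (s := Metric.closedBall r₀ 1) (Metric.closedBall_mem_nhds _ one_pos)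
    (Eventually.of_forall fun r =>
      (hw.mul (hψc.comp (by fun_prop))).aestronglyMeasurable)
    (hint (hw.mul (hψc.comp (by fun_prop))))
    ((hF'.comp (by fun_prop : Continuous fun ξ : Sph => (r₀, ξ))).aestronglyMeasurable)
    (ae_of_all _ fun ξ r hr => hM (r, ξ) ⟨hr, mem_univ _⟩)
    (integrable_const _)
    (ae_of_all _ fun ξ r _ => by
      have h1 : HasDerivAt (fun r : ℝ => r • (ξ : E3)) (ξ : E3) r := by
        simpa using (hasDerivAt_id r).smul_const (ξ : E3)
      exact (((hψ.differentiable (by norm_num)).differentiableAt.hasFDerivAt.comp_hasDerivAt r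
        h1).const_mul (w ξ)))
  refine h.2.congr_deriv ?_
  rw [← integral_finsetSum]
  · congr 1 with ξ
    have h2 : (ξ : E3) = ∑ i, (ξ : E3) i • EuclideanSpace.basisFun (Fin 3) ℝ i := by
      simpa using ((EuclideanSpace.basisFun (Fin 3) ℝ).sum_repr (ξ : E3)).symm
    conv_lhs => rw [show (fderiv ℝ ψ (r₀ • (ξ : E3))) (ξ : E3) = (fderiv ℝ ψ (r₀ • (ξ : E3)))
      (∑ i, (ξ : E3) i • EuclideanSpace.basisFun (Fin 3) ℝ i) by rw [← h2]]
    rw [map_sum, Finset.mul_sum]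
    refine Finset.sum_congr rfl fun i _ => ?_
    rw [map_smul, smul_eq_mul, mul_assoc]
  · intro i _
    refine hint ((hw.mul (by fun_prop)).mul ((hfd.comp (by fun_prop)).clm_apply continuous_const))

lemma contDiff_angularIntegral (m : ℕ) {w : Sph → ℝ} (hw : Continuous w) {ψ : E3 → ℝ}
    (hψ : ContDiff ℝ ∞ ψ) :
    ContDiff ℝ m (fun r : ℝ => ∫ ξ : Sph, w ξ * ψ (r • (ξ : E3)) ∂surface) := by
  have hψ1 : ∀ {ψ : E3 → ℝ}, ContDiff ℝ ∞ ψ → ContDiff ℝ 1 ψ := fun h =>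
    h.of_le (by exact_mod_cast le_top)
  induction m generalizing w ψ with
  | zero =>
    exact contDiff_zero.2 (continuous_iff_continuousAt.2 fun r =>
      (hasDerivAt_angularIntegral hw (hψ1 hψ) r).continuousAt)
  | succ m ih =>
    have hd := hasDerivAt_angularIntegral hw (hψ1 hψ)
    push_cast
    refine contDiff_succ_iff_deriv.2 ⟨fun r => (hd r).differentiableAt, by simp, ?_⟩
    rw [funext fun r => (hd r).deriv]
    refine ContDiff.sum fun i _ => ih (hw.mul (by fun_prop))
      (ψ := fun y => fderiv ℝ ψ y (EuclideanSpace.basisFun (Fin 3) ℝ i)) ?_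
    exact (hψ.fderiv_right (m := ∞) (by simp)).clm_apply contDiff_const

lemma contDiff_angular (n : E3) (l : ℕ) {ψ : E3 → ℝ} (hψ : ContDiff ℝ ∞ ψ) :
    ContDiff ℝ ∞ (angular n l ψ) :=
  contDiff_infty.2 fun m => contDiff_angularIntegral m (continuous_zonal n l) hψ

lemma exists_annulus (ψ : 𝓓(punctured, ℝ)) :
    ∃ a b : ℝ, 0 < a ∧ ∀ x : E3, ψ x ≠ 0 → a ≤ ‖x‖ ∧ ‖x‖ ≤ b := by
  have hK : IsCompact (tsupport ψ) := ψ.hasCompactSupport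
  have hpos : ∀ x ∈ tsupport ψ, 0 < ‖x‖ := fun x hx => norm_pos_iff.2 (ψ.tsupport_subset hx)
  obtain ⟨A, hA⟩ := hK.exists_bound_of_continuousOn (f := fun x : E3 => ‖x‖⁻¹)
    (continuous_norm.continuousOn.inv₀ fun x hx => (hpos x hx).ne')
  obtain ⟨B, hB⟩ := hK.isBounded.exists_norm_le
  refine ⟨(|A| + 1)⁻¹, B, by positivity, fun x hx => ⟨?_, hB x (subset_tsupport _ hx)⟩⟩
  have hx' := subset_tsupport ψ hx
  have h2 := hA x hx'
  rw [norm_inv, norm_norm] at h2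
  exact inv_le_of_inv_le₀ (hpos x hx') (by linarith [le_abs_self A])

lemma exists_angularTest (n : E3) (l : ℕ) (ψ : 𝓓(punctured, ℝ)) :
    ∃ g : 𝓓(halfLine, ℝ), ∀ r, 0 < r → g r = angular n l ψ r := by
  obtain ⟨a, b, ha, hab⟩ := exists_annulus ψ
  have hzero : ∀ r, ¬ (a ≤ |r| ∧ |r| ≤ b) → angular n l ψ r = 0 := by
    intro r hr
    have h : ∀ ξ : Sph, ψ (r • (ξ : E3)) = 0 := fun ξ => by
      by_contra h
      have := hab _ h
      rw [norm_smul, norm_sph_coe, mul_one, Real.norm_eq_abs] at this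
      exact hr this
    simp [angular, h]
  -- The angular integral is also defined, and may be nonzero, at negative `r`. The cutoff vanishes
  -- for `r ≤ 0` and equals `1` for `r ≥ a`, so nothing changes on `(0, ∞)`.
  set χ : ℝ → ℝ := fun r => Real.smoothTransition (r / a) with hχ
  have hsub : tsupport (fun r => χ r * angular n l ψ r) ⊆ Icc a b := by
    refine closure_minimal (fun r hr => ?_) isClosed_Icc
    by_contra h
    apply hr
    rcases le_or_gt r 0 with h0 | h0
    · simp [hχ, Real.smoothTransition.zero_of_nonpos (div_nonpos_of_nonpos_of_nonneg h0 ha.le)]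
    · simp only
      rw [hzero r (by rwa [abs_of_pos h0]), mul_zero]
  refine ⟨⟨fun r => χ r * angular n l ψ r, ?_, ?_, ?_⟩, fun r hr => ?_⟩
  · exact (Real.smoothTransition.contDiff.comp (contDiff_id.div_const a)).mul
      (contDiff_angular n l ψ.contDiff)
  · exact isCompact_Icc.of_isClosed_subset (isClosed_tsupport _) hsub
  · exact fun r hr => lt_of_lt_of_le ha (hsub hr).1
  · change χ r * angular n l ψ r = angular n l ψ r
    by_cases h : a ≤ |r| ∧ |r| ≤ b
    · rw [abs_of_pos hr] at h
      rw [hχ]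
      simp only
      rw [Real.smoothTransition.one_of_one_le ((one_le_div ha).2 h.1), one_mul]
    · rw [hzero r h, mul_zero]

lemma continuousOn_angular (n : E3) (l : ℕ) {F : E3 → ℝ} (hF : ContinuousOn F {0}ᶜ) :
    ContinuousOn (angular n l F) (Ioi 0) := by
  refine continuousOn_integral_of_compact_support (k := univ) isCompact_univ ?_
    fun _ ξ _ h => absurd (mem_univ ξ) h
  have h1 : ContinuousOn (fun p : ℝ × Sph => F (p.1 • (p.2 : E3))) (Ioi 0 ×ˢ univ) := by
    refine hF.comp (by fun_prop) ?_
    rintro ⟨r, ξ⟩ ⟨hr, -⟩ h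
    have h2 := congrArg norm (mem_singleton_iff.1 h)
    rw [norm_smul, norm_sph_coe, mul_one, norm_zero, norm_eq_zero] at h2
    exact (ne_of_gt hr) h2
  exact ((continuous_zonal n l).comp continuous_snd).continuousOn.mul h1

lemma continuousOn_radialOp_zero (l : ℕ) (f : 𝓓(halfLine, ℝ)) :
    ContinuousOn (radialOp 0 l f) (Ioi 0) := by
  have h1 := f.continuous
  have h2 := (derivTest f).continuous
  have h3 := (derivTest (derivTest f)).continuous
  have h0 : ∀ r ∈ Ioi (0 : ℝ), r ≠ 0 := fun r hr => ne_of_gt hr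
  have h4 : ContinuousOn (fun r => -(derivTest (derivTest f) r + 2 / r * derivTest f r
      - (l : ℝ) * (l + 1) / r ^ 2 * f r)) (Ioi 0) :=
    ((h3.continuousOn.add ((continuousOn_const.div continuousOn_id h0).mul h2.continuousOn)).sub
      ((continuousOn_const.div (continuousOn_id.pow 2) fun r hr => pow_ne_zero 2 (h0 r hr)).mul
        h1.continuousOn)).neg
  refine h4.congr fun r hr => ?_
  rw [radialOp_eq 0 l f hr]
  simp

lemma ae_eq_of_forall_integral_testFunction {F G : ℝ → ℝ} (hF : ContinuousOn F (Ioi 0))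
    (hG : ContinuousOn G (Ioi 0))
    (h : ∀ f : 𝓓(halfLine, ℝ), ∫ r, f r * F r ∂radialMeasure = ∫ r, f r * G r ∂radialMeasure) :
    F =ᵐ[radialMeasure] G := by
  have h1 := IsOpen.ae_eq_zero_of_integral_contDiff_smul_eq_zero (f := fun r => F r - G r)
    (μ := radialMeasure) isOpen_Ioi ((hF.sub hG).locallyIntegrableOn measurableSet_Ioi) ?_
  · filter_upwards [h1, ae_radialMeasure_pos] with r h2 h3
    exact sub_eq_zero.1 (h2 h3)
  · intro g hg1 hg2 hg3
    set f : 𝓓(halfLine, ℝ) := ⟨g, hg1, hg2, hg3⟩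
    have hi : ∀ {F : ℝ → ℝ}, ContinuousOn F (Ioi 0) →
        Integrable (fun r => f r * F r) radialMeasure := fun hF => by
      simpa only [mul_comm] using
        integrable_mul_testFunction (μ := radialMeasure) (Ω := halfLine) hF f
    have h2 := h f
    rw [← sub_eq_zero, ← integral_sub (hi hF) (hi hG)] at h2
    rw [← h2]
    congr 1 with r
    change f r * (F r - G r) = _
    ring

/-- By duality: tested against `f`, the Laplacian moves onto the lift of `f`, where it is the radial
operator with `V = 0`, which moves back by its own symmetry. No differentiation on the sphere is
needed. -/
lemma angular_laplacian_ae {n : E3} (hn : ‖n‖ = 1) (l : ℕ) (ψ : 𝓓(punctured, ℝ))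
    (g : 𝓓(halfLine, ℝ)) (hg : ∀ r, 0 < r → g r = angular n l ψ r) :
    (fun r => -angular n l (Laplacian.laplacian (ψ : E3 → ℝ)) r)
      =ᵐ[radialMeasure] radialOp 0 l g := by
  refine ae_eq_of_forall_integral_testFunction
    (continuousOn_angular n l (continuous_laplacian_testFunction ψ).continuousOn).neg
    (continuousOn_radialOp_zero l g) fun f => ?_
  have h0 : ∀ a b : ℝ, 0 < a → a < b → MemLp (0 : ℝ → ℝ) 2 (volume.restrict (Icc a b)) :=
    fun _ _ _ _ => MemLp.zero
  have hfl := fullOp_lift_ae 0 hn l f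
  have hint : Integrable (fun x => lift n l (radialOp 0 l f) x * ψ x) volume :=
    (memLp_lift l hn (memLp_radialOp h0 l f)).integrable_mul (q := 2)
      (ψ.continuous.memLp_of_hasCompactSupport ψ.hasCompactSupport)
  calc ∫ r, f r * -angular n l (Laplacian.laplacian (ψ : E3 → ℝ)) r ∂radialMeasure
      = -∫ x, liftTest n l f x * Laplacian.laplacian (ψ : E3 → ℝ) x := by
        rw [coe_liftTest, integral_lift_mul n l (integrable_mul_laplacian (liftTest n l f) ψ)]
        simp only [mul_neg, integral_neg]
    _ = ∫ x, liftTest n l f x * fullOp 0 ψ x := by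
        rw [← integral_neg]
        congr 1 with x
        simp [fullOp]
    _ = ∫ x, lift n l (radialOp 0 l f) x * ψ x := by
        rw [integral_fullOp_symm]
        refine integral_congr_ae ?_
        filter_upwards [hfl] with x hx
        rw [coe_liftTest, hx]
    _ = ∫ r, radialOp 0 l f r * g r ∂radialMeasure := by
        rw [integral_lift_mul n l hint]
        refine integral_congr_ae ?_
        filter_upwards [ae_radialMeasure_pos] with r hr
        rw [hg r hr]
    _ = _ := (integral_radialOp_symm h0 l f g).symm

lemma angular_fullOp_ae (V : ℝ → ℝ) {n : E3} (hn : ‖n‖ = 1) (l : ℕ) (ψ : 𝓓(punctured, ℝ))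
    (g : 𝓓(halfLine, ℝ)) (hg : ∀ r, 0 < r → g r = angular n l ψ r) :
    angular n l (fullOp V ψ) =ᵐ[radialMeasure] radialOp V l g := by
  filter_upwards [angular_laplacian_ae hn l ψ g hg, ae_radialMeasure_pos] with r h1 hr
  have hint : ∀ {F : E3 → ℝ}, Continuous F →
      Integrable (fun ξ : Sph => (legendre l).eval ⟪n, ξ⟫_ℝ * F (r • (ξ : E3))) surface := fun hF =>
    ((continuous_zonal n l).mul (hF.comp (by fun_prop))).integrable_of_hasCompactSupport
      (HasCompactSupport.of_compactSpace _)
  have h2 : radialOp V l g r = radialOp 0 l g r + V r * g r := by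
    rw [radialOp_eq V l g hr, radialOp_eq 0 l g hr]
    simp
  rw [h2, ← h1, hg r hr]
  simp only [angular]
  have h3 : Integrable (fun ξ : Sph => -((legendre l).eval ⟪n, ξ⟫_ℝ *
      Laplacian.laplacian (ψ : E3 → ℝ) (r • (ξ : E3)))) surface :=
    (hint (continuous_laplacian_testFunction ψ)).neg
  rw [← integral_const_mul, ← integral_neg,
    ← integral_add h3 ((hint ψ.continuous).const_mul (V r))]
  congr 1 with ξ
  rw [fullOp, norm_smul, norm_sph_coe, mul_one, Real.norm_of_nonneg hr.le]
  ring

end Angular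

/-! ### Lifting the radial heat flow -/

section PartialWaves

lemma inner_liftL2_left {n : E3} (hn : ‖n‖ = 1) (l : ℕ) (R : Lp ℝ 2 radialMeasure)
    {q : Lp ℝ 2 (volume : Measure E3)} {ψ : E3 → ℝ} (hq : q =ᵐ[volume] ψ) :
    ⟪liftL2 hn l R, q⟫_ℝ = ∫ r, R r * angular n l ψ r ∂radialMeasure := by
  have hψ : MemLp ψ 2 volume := (memLp_congr_ae hq).1 (Lp.memLp q)
  rw [inner_eq_integral_of_ae_eq (coeFn_liftL2 l hn R) hq, integral_lift_mul n l
    ((memLp_lift l hn (Lp.memLp R)).integrable_mul hψ)]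

/-- The lift multiplies norms and forms by constants, which preserves the form domain. For the
adjoint condition, pairing a lift with `ψ` is pairing the radial function with the angular
projection of `ψ`, a test function on which `D_l` acts as `D` does on `ψ`. -/
lemma liftL2_mem_friedrichs {V : ℝ → ℝ}
    (hV : ∀ a b : ℝ, 0 < a → a < b → MemLp V 2 (volume.restrict (Icc a b))) {n : E3}
    (hn : ‖n‖ = 1) (l : ℕ) {p : Lp ℝ 2 radialMeasure × Lp ℝ 2 radialMeasure}
    (hp : p ∈ friedrichs (minimalGraph radialMeasure halfLine (radialOp V l))) :
    (liftL2 hn l p.1, liftL2 hn l p.2) ∈ friedrichs (minimalGraph volume punctured (fullOp V)) := by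
  obtain ⟨⟨a, ha, ha1, ha2⟩, hadj⟩ := hp
  refine ⟨⟨fun k => (liftL2 hn l (a k).1, liftL2 hn l (a k).2), fun k => ?_, ?_, ?_⟩, ?_⟩
  · obtain ⟨f, h1, h2⟩ := ha k
    exact ⟨liftTest n l f, coeFn_liftL2_of_ae_eq l hn h1,
      (coeFn_liftL2_of_ae_eq l hn h2).trans (fullOp_lift_ae V hn l f).symm⟩
  · exact ((liftL2 hn l).continuous.tendsto _).comp ha1
  · simp only [← map_sub, inner_liftL2]
    simpa using ha2.const_mul (zonalSq n l)
  · rintro q ⟨ψ, h1, h2⟩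
    obtain ⟨g, hg⟩ := exists_angularTest n l ψ
    have hs := hadj ((memLp_testFunction g).toLp, (memLp_radialOp hV l g).toLp)
      ⟨g, (memLp_testFunction g).coeFn_toLp, (memLp_radialOp hV l g).coeFn_toLp⟩
    rw [inner_eq_integral_of_ae_eq (ae_eq_refl _) (memLp_radialOp hV l g).coeFn_toLp,
      inner_eq_integral_of_ae_eq (ae_eq_refl _) (memLp_testFunction g).coeFn_toLp] at hs
    rw [inner_liftL2_left hn l _ h2, inner_liftL2_left hn l _ h1]
    calc _ = ∫ r, p.1 r * radialOp V l g r ∂radialMeasure := by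
          refine integral_congr_ae ?_
          filter_upwards [angular_fullOp_ae V hn l ψ g hg] with r hr
          rw [hr]
      _ = ∫ r, p.2 r * g r ∂radialMeasure := hs
      _ = _ := by
          refine integral_congr_ae ?_
          filter_upwards [ae_radialMeasure_pos] with r hr
          rw [hg r hr]

lemma isHeatSolution_liftL2 {V : ℝ → ℝ}
    (hV : ∀ a b : ℝ, 0 < a → a < b → MemLp V 2 (volume.restrict (Icc a b))) {n : E3}
    (hn : ‖n‖ = 1) (l : ℕ) {u : ℝ → Lp ℝ 2 radialMeasure}
    (hu : IsHeatSolution (friedrichs (minimalGraph radialMeasure halfLine (radialOp V l))) u) :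
    IsHeatSolution (friedrichs (minimalGraph volume punctured (fullOp V)))
      fun t => liftL2 hn l (u t) where
  deriv t ht := by
    obtain ⟨w, h1, h2⟩ := hu.deriv t ht
    refine ⟨liftL2 hn l w, liftL2_mem_friedrichs hV hn l h1, ?_⟩
    rw [← map_neg]
    exact (liftL2 hn l).hasFDerivAt.comp_hasDerivAt t h2
  tendsto := ((liftL2 hn l).continuous.tendsto _).comp hu.tendsto

variable {V : ℝ → ℝ} {c : ℝ} {K : ℝ → E3 → E3 → ℝ} {Kl : ℝ → ℝ → ℝ → ℝ} {n : E3} {l : ℕ}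

/-- Both sides are heat solutions of `D` with the same initial value, hence equal almost everywhere,
and by continuity everywhere off the origin. -/
lemma integral_kernel_mul_lift
    (hV : ∀ a b : ℝ, 0 < a → a < b → MemLp V 2 (volume.restrict (Icc a b)))
    (hc : IsSemiboundedExpr volume punctured (fullOp V) c)
    (hK : IsHeatKernel volume punctured (fullOp V) K)
    (hKl : IsHeatKernel radialMeasure halfLine (radialOp V l) Kl) (hn : ‖n‖ = 1)
    (f : 𝓓(halfLine, ℝ)) {t : ℝ} (ht : 0 < t) {x : E3} (hx : x ≠ 0) :
    ∫ y, K t x y * lift n l f y = lift n l (fun r => ∫ s, Kl t r s * f s ∂radialMeasure) x := by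
  obtain ⟨u, hu, hut, hu0⟩ := hK.exists_solution (liftTest n l f)
  obtain ⟨v, hv, hvt, hv0⟩ := hKl.exists_solution f
  have h0 : u 0 = liftL2 hn l (v 0) :=
    Lp.ext (hu0.trans (coeFn_liftL2_of_ae_eq l hn hv0).symm)
  have h1 := hu.unique hc.friedrichs_symm (isHeatSolution_liftL2 hV hn l hv) h0 ht
  have h2 : (fun x => ∫ y, K t x y * lift n l f y) =ᵐ[volume]
      lift n l (fun r => ∫ s, Kl t r s * f s ∂radialMeasure) := by
    refine (hut t ht).symm.trans ?_
    rw [h1]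
    exact coeFn_liftL2_of_ae_eq l hn (hvt t ht)
  refine Measure.eqOn_open_of_ae_eq (μ := volume) (U := {0}ᶜ) (ae_restrict_of_ae h2)
    isOpen_compl_singleton (hK.continuousOn_integral ht (liftTest n l f)) ?_ hx
  have h3 : ContinuousOn (fun x : E3 => ‖x‖) {0}ᶜ := continuous_norm.continuousOn
  refine ContinuousOn.mul ((hKl.continuousOn_integral ht f).comp h3 fun x hx => ?_) ?_
  · exact norm_pos_iff.2 hx
  · exact (legendre l).continuous.comp_continuousOn
      ((by fun_prop : Continuous fun x : E3 => ⟪n, x⟫_ℝ).continuousOn.div h3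
        fun x hx => norm_ne_zero_iff.2 hx)

/-- The preceding identity with the arbitrary radial test function removed. Rotation invariance of
`K` is not assumed; it will be a consequence. -/
lemma angular_kernel
    (hV : ∀ a b : ℝ, 0 < a → a < b → MemLp V 2 (volume.restrict (Icc a b)))
    (hc : IsSemiboundedExpr volume punctured (fullOp V) c)
    (hK : IsHeatKernel volume punctured (fullOp V) K)
    (hKl : IsHeatKernel radialMeasure halfLine (radialOp V l) Kl) (hn : ‖n‖ = 1)
    {t : ℝ} (ht : 0 < t) {x : E3} (hx : x ≠ 0) {r : ℝ} (hr : 0 < r) :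
    angular n l (K t x) r = (legendre l).eval (⟪n, x⟫_ℝ / ‖x‖) * Kl t ‖x‖ r := by
  have hKx : ContinuousOn (K t x) {0}ᶜ := hK.continuousOn_apply ht hx
  have hKlx : ContinuousOn (Kl t ‖x‖) (Ioi 0) :=
    hKl.continuousOn_apply ht (show ‖x‖ ∈ halfLine from norm_pos_iff.2 hx)
  have h1 := ae_eq_of_forall_integral_testFunction (continuousOn_angular n l hKx)
    (G := fun r => (legendre l).eval (⟪n, x⟫_ℝ / ‖x‖) * Kl t ‖x‖ r)
    (continuousOn_const.mul hKlx) fun f => ?_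
  · have h2 : ∀ᵐ r ∂(volume.restrict (Ioi (0 : ℝ))), angular n l (K t x) r
        = (legendre l).eval (⟪n, x⟫_ℝ / ‖x‖) * Kl t ‖x‖ r := by
      have h3 := (ae_withDensity_iff (by fun_prop)).1 h1
      filter_upwards [h3, ae_restrict_mem measurableSet_Ioi] with r h4 h5
      refine h4 ?_
      have : 0 < r := h5
      simp only [ne_eq, ENNReal.ofReal_eq_zero, not_le]
      positivity
    exact Measure.eqOn_open_of_ae_eq (μ := volume) h2 isOpen_Ioi (continuousOn_angular n l hKx)
      (continuousOn_const.mul hKlx) hr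
  · have h2 := integral_kernel_mul_lift hV hc hK hKl hn f ht hx
    have h3 : Integrable (fun y => lift n l f y * K t x y) volume := by
      simpa only [mul_comm, coe_liftTest] using
        integrable_mul_testFunction (μ := volume) (Ω := punctured) hKx (liftTest n l f)
    simp_rw [mul_comm (K t x _)] at h2
    rw [integral_lift_mul n l h3] at h2
    rw [h2, lift, ← integral_mul_const]
    congr 1 with r
    ring

end PartialWaves

/-! ### Archimedes' hat-box theorem for zonal integrals -/

section HatBox

lemma inner_sph_mem {n : E3} (hn : ‖n‖ = 1) (ξ : Sph) : ⟪n, (ξ : E3)⟫_ℝ ∈ Icc (-1 : ℝ) 1 := by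
  have h := abs_real_inner_le_norm n (ξ : E3)
  rw [hn, norm_sph_coe, one_mul] at h
  exact abs_le.1 h

lemma integrable_sph {g : Sph → ℝ} (hg : Continuous g) : Integrable g surface :=
  hg.integrable_of_hasCompactSupport (HasCompactSupport.of_compactSpace _)

lemma surface_real_univ : surface.real univ = 4 * Real.pi := by
  rw [Measure.toSphere_real_apply_univ, Measure.real, EuclideanSpace.volume_ball_fin_three]
  simp
  rw [ENNReal.toReal_ofReal (by positivity)]
  ring

/-- Zonal harmonics of degrees `0` and `l` have different eigenvalues. Symmetry of `-∇²` on the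
lifts of one `f` in these degrees gives `I * ∫ l(l+1)/r² f² = 0`, and the second factor is nonzero.
-/
lemma integral_zonal_eq_zero {n : E3} (hn : ‖n‖ = 1) {l : ℕ} (hl : l ≠ 0) :
    ∫ ξ : Sph, (legendre l).eval ⟪n, ξ⟫_ℝ ∂surface = 0 := by
  set I := ∫ ξ : Sph, (legendre l).eval ⟪n, ξ⟫_ℝ ∂surface with hI
  obtain ⟨f, hf0, -, hf1⟩ := exists_testFunction_integral_eq_one (μ := radialMeasure)
    (Ω := halfLine) (x := 1) (fun U h1 h2 h3 => radialMeasure_pos h1 h2 h3)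
    (show (1 : ℝ) ∈ Ioi (0 : ℝ) by simp) univ_mem
  have h0 : ∀ a b : ℝ, 0 < a → a < b → MemLp (0 : ℝ → ℝ) 2 (volume.restrict (Icc a b)) :=
    fun _ _ _ _ => MemLp.zero
  have hang : ∀ g : ℝ → ℝ, ∀ r, 0 < r → angular n 0 (lift n l g) r = I * g r := by
    intro g r hr
    simp only [angular, lift_smul n l g hr]
    rw [hI, ← integral_mul_const]
    congr 1 with ξ
    simp [legendre]
    ring
  have hint : ∀ {g h : ℝ → ℝ}, MemLp g 2 radialMeasure → MemLp h 2 radialMeasure →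
      ∫ x, lift n 0 g x * lift n l h x = I * ∫ r, g r * h r ∂radialMeasure := by
    intro g h hg hh
    rw [integral_lift_mul n 0 ((memLp_lift 0 hn hg).integrable_mul (memLp_lift l hn hh)),
      ← integral_const_mul]
    refine integral_congr_ae ?_
    filter_upwards [ae_radialMeasure_pos] with r hr
    rw [hang h r hr]
    ring
  have hsym := integral_fullOp_symm 0 (liftTest n 0 f) (liftTest n l f)
  have e1 : ∫ x, liftTest n 0 f x * fullOp 0 (liftTest n l f) x
      = I * ∫ r, f r * radialOp 0 l f r ∂radialMeasure := by
    rw [← hint (memLp_testFunction f) (memLp_radialOp h0 l f)]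
    refine integral_congr_ae ?_
    filter_upwards [fullOp_lift_ae 0 hn l f] with x hx
    rw [coe_liftTest, coe_liftTest, hx]
  have e2 : ∫ x, fullOp 0 (liftTest n 0 f) x * liftTest n l f x
      = I * ∫ r, radialOp 0 0 f r * f r ∂radialMeasure := by
    rw [← hint (memLp_radialOp h0 0 f) (memLp_testFunction f)]
    refine integral_congr_ae ?_
    filter_upwards [fullOp_lift_ae 0 hn 0 f] with x hx
    rw [coe_liftTest, coe_liftTest, hx]
  have i1 : Integrable (fun r => f r * radialOp 0 l f r) radialMeasure :=
    (memLp_testFunction f).integrable_mul (memLp_radialOp h0 l f)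
  have i2 : Integrable (fun r => radialOp 0 0 f r * f r) radialMeasure :=
    (memLp_radialOp h0 0 f).integrable_mul (memLp_testFunction f)
  rw [e1, e2, ← sub_eq_zero, ← mul_sub, ← integral_sub i1 i2] at hsym
  refine (mul_eq_zero.1 hsym).resolve_right fun hz => ?_
  have hcent : (fun r => f r * radialOp 0 l f r - radialOp 0 0 f r * f r)
      =ᵐ[radialMeasure] fun r => (l : ℝ) * (l + 1) / r ^ 2 * f r * f r := by
    filter_upwards [ae_radialMeasure_pos] with r hr
    rw [radialOp_eq 0 l f hr, radialOp_eq 0 0 f hr]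
    simp
    ring
  have hci : Integrable (fun r => (l : ℝ) * (l + 1) / r ^ 2 * f r * f r) radialMeasure :=
    (i1.sub i2).congr hcent
  rw [integral_congr_ae hcent, integral_eq_zero_iff_of_nonneg (fun r => by
    have := hf0 r
    simp only [Pi.zero_apply]
    positivity) hci] at hz
  have hf : f =ᵐ[radialMeasure] fun _ => (0 : ℝ) := by
    filter_upwards [hz, ae_radialMeasure_pos] with r h1 h2
    have h3 : (l : ℝ) * (l + 1) / r ^ 2 ≠ 0 := by
      have : (l : ℝ) ≠ 0 := by exact_mod_cast hl
      positivity
    simpa [mul_assoc, h3] using h1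
  rw [integral_congr_ae hf] at hf1
  simp at hf1

/-- By linearity only Legendre polynomials matter: both sides vanish for `l > 0`, and for `l = 0`
both equal the area `4π`. -/
lemma integral_zonal_polynomial {n : E3} (hn : ‖n‖ = 1) (q : ℝ[X]) :
    ∫ ξ : Sph, q.eval ⟪n, (ξ : E3)⟫_ℝ ∂surface = 2 * Real.pi * ∫ s in (-1 : ℝ)..1, q.eval s := by
  have hc : ∀ q : ℝ[X], Continuous fun ξ : Sph => q.eval ⟪n, (ξ : E3)⟫_ℝ := fun q =>
    q.continuous.comp (by fun_prop)
  have hi : ∀ q : ℝ[X], IntervalIntegrable (fun s => q.eval s) volume (-1) 1 := fun q =>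
    q.continuous.intervalIntegrable _ _
  induction q using forall_polynomial_of_legendre with
  | h0 => simp
  | hadd q r hq hr =>
    simp only [eval_add]
    rw [integral_add (integrable_sph (hc q)) (integrable_sph (hc r)),
      intervalIntegral.integral_add (hi q) (hi r), hq, hr, mul_add]
  | hsmul c q hq =>
    simp only [eval_smul, smul_eq_mul]
    rw [integral_const_mul, intervalIntegral.integral_const_mul, hq]
    ring
  | hP l =>
    rcases Nat.eq_zero_or_pos l with h | h
    · subst h
      have := surface_real_univ
      simp [legendre, this]
      ring
    · rw [integral_zonal_eq_zero hn h.ne']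
      have := integral_legendre_mul_legendre_of_ne h.ne'
      simp only [legendre, pow_zero, Nat.factorial_zero, Function.iterate_zero] at this
      simp at this
      rw [show ∫ s in (-1 : ℝ)..1, (legendre l).eval s = 0 by simpa [legendre] using this,
        mul_zero]

lemma integral_zonal {n : E3} (hn : ‖n‖ = 1) {k : ℝ → ℝ} (hk : ContinuousOn k (Icc (-1) 1)) :
    ∫ ξ : Sph, k ⟪n, (ξ : E3)⟫_ℝ ∂surface = 2 * Real.pi * ∫ s in (-1 : ℝ)..1, k s := by
  have hkc : Continuous fun ξ : Sph => k ⟪n, (ξ : E3)⟫_ℝ :=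
    hk.comp_continuous (by fun_prop) (inner_sph_mem hn)
  have hki : IntervalIntegrable k volume (-1) 1 := by
    refine ContinuousOn.intervalIntegrable ?_
    rwa [uIcc_of_le (by norm_num)]
  rw [← sub_eq_zero, ← abs_eq_zero]
  refine le_antisymm (le_of_forall_pos_le_add fun ε hε => ?_) (abs_nonneg _)
  rw [zero_add]
  have hπ := Real.pi_pos
  -- The error is `ε / 2` on each side: the sphere has area `4π`, and the interval has length `2`
  -- with prefactor `2π`.
  obtain ⟨q, hq⟩ := exists_polynomial_near_of_continuousOn _ _ k hk (ε / (8 * Real.pi))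
    (by positivity)
  have hqc : Continuous fun ξ : Sph => q.eval ⟪n, (ξ : E3)⟫_ℝ := q.continuous.comp (by fun_prop)
  have h1 : |(∫ ξ : Sph, q.eval ⟪n, (ξ : E3)⟫_ℝ ∂surface) - ∫ ξ : Sph, k ⟪n, (ξ : E3)⟫_ℝ ∂surface|
      ≤ ε / 2 := by
    rw [← integral_sub (integrable_sph hqc) (integrable_sph hkc), ← Real.norm_eq_abs]
    refine (norm_integral_le_of_norm_le_const (C := ε / (8 * Real.pi)) (ae_of_all _ fun ξ =>
      (hq _ (inner_sph_mem hn ξ)).le)).trans (le_of_eq ?_)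
    rw [surface_real_univ]
    field_simp
    ring
  have h2 : |(∫ s in (-1 : ℝ)..1, q.eval s) - ∫ s in (-1 : ℝ)..1, k s| ≤ ε / (4 * Real.pi) := by
    rw [← intervalIntegral.integral_sub (q.continuous.intervalIntegrable _ _) hki,
      ← Real.norm_eq_abs]
    refine (intervalIntegral.norm_integral_le_of_norm_le_const (C := ε / (8 * Real.pi))
      fun s hs => (hq s ?_).le).trans (le_of_eq ?_)
    · rw [uIoc_of_le (by norm_num)] at hs
      exact Ioc_subset_Icc_self hs
    · norm_num
      field_simp
      norm_num
  have h3 : |2 * Real.pi * (∫ s in (-1 : ℝ)..1, q.eval s) - 2 * Real.pi * ∫ s in (-1 : ℝ)..1, k s|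
      ≤ ε / 2 := by
    rw [← mul_sub, abs_mul, abs_of_pos (by positivity)]
    calc _ ≤ 2 * Real.pi * (ε / (4 * Real.pi)) := by gcongr
      _ = ε / 2 := by field_simp; norm_num
  rw [← integral_zonal_polynomial hn q] at h3
  rw [abs_le] at *
  constructor <;> linarith [h1.1, h1.2, h3.1, h3.2]

end HatBox

/-! ### Isometries of the sphere and totality of zonal functions -/

section Rotation

/-- A linear isometry acts on the unit sphere. -/
def sphMap (ρ : E3 ≃ₗᵢ[ℝ] E3) (ξ : Sph) : Sph := ⟨ρ ξ, by simp⟩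

open scoped Pointwise in
-- The surface measure of a set is a multiple of the volume of the cone over it, and `ρ` respects
-- cones and volume.
lemma measurePreserving_sphMap (ρ : E3 ≃ₗᵢ[ℝ] E3) :
    MeasurePreserving (sphMap ρ) surface surface := by
  have hm : Measurable (sphMap ρ) :=
    (Continuous.subtype_mk (ρ.continuous.comp continuous_subtype_val) _).measurable
  refine ⟨hm, ?_⟩
  ext s hs
  rw [Measure.map_apply hm hs, Measure.toSphere_apply' _ (hm hs), Measure.toSphere_apply' _ hs]
  congr 1
  have h : ρ ⁻¹' (Ioo (0 : ℝ) 1 • ((↑) '' s : Set E3))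
      = Ioo (0 : ℝ) 1 • ((↑) '' (sphMap ρ ⁻¹' s) : Set E3) := by
    ext x
    simp only [mem_preimage, Set.mem_smul, mem_image]
    constructor
    · rintro ⟨a, ha, _, ⟨ξ, hξ, rfl⟩, h⟩
      have h2 : sphMap ρ (sphMap ρ.symm ξ) = ξ := by
        apply Subtype.ext
        simp [sphMap]
      refine ⟨a, ha, _, ⟨sphMap ρ.symm ξ, ?_, rfl⟩, ?_⟩
      · rwa [h2]
      · apply ρ.injective
        rw [map_smul, ← h]
        congr 1
        exact congrArg Subtype.val h2
    · rintro ⟨a, ha, _, ⟨ξ, hξ, rfl⟩, h⟩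
      exact ⟨a, ha, _, ⟨_, hξ, rfl⟩, by rw [← h, map_smul]; rfl⟩
  rw [← h]
  exact (ρ.measurePreserving.measure_preimage_emb
    ρ.toHomeomorph.measurableEmbedding _).symm ▸ rfl

lemma integral_sphMap (ρ : E3 ≃ₗᵢ[ℝ] E3) {g : Sph → ℝ} (hg : Continuous g) :
    ∫ ξ, g (sphMap ρ ξ) ∂surface = ∫ ξ, g ξ ∂surface := by
  have h := measurePreserving_sphMap ρ
  conv_rhs => rw [← h.map_eq]
  rw [integral_map h.measurable.aemeasurable hg.aestronglyMeasurable]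

/-- The exponential `ξ ↦ exp ⟪a, ξ⟫` on the sphere. -/
def expInner (a : E3) : C(Sph, ℝ) := ⟨fun ξ => Real.exp ⟪a, (ξ : E3)⟫_ℝ, by fun_prop⟩

lemma expInner_add (a b : E3) : expInner (a + b) = expInner a * expInner b := by
  ext ξ
  simp [expInner, inner_add_left, Real.exp_add]

lemma closure_range_expInner : (Submonoid.closure (range expInner) : Set C(Sph, ℝ)) = range expInner := by
  refine Subset.antisymm (fun g hg => ?_) Submonoid.subset_closure
  induction hg using Submonoid.closure_induction with
  | mem x hx => exact hx
  | one => exact ⟨0, by ext ξ; simp [expInner]⟩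
  | mul x y _ _ hx hy =>
    obtain ⟨a, rfl⟩ := hx
    obtain ⟨b, rfl⟩ := hy
    exact ⟨a + b, expInner_add a b⟩

/-- Exponentials are closed under products, so their span is an algebra; it separates points, and
Stone–Weierstrass applies. -/
lemma eq_zero_of_forall_expInner {h : Sph → ℝ} (hc : Continuous h)
    (h0 : ∀ a, ∫ ξ, expInner a ξ * h ξ ∂surface = 0) : h = 0 := by
  have hi : ∀ g : C(Sph, ℝ), Integrable (fun ξ => g ξ * h ξ) surface := fun g =>
    integrable_sph (g.continuous.mul hc)
  have hspan : ∀ g ∈ Submodule.span ℝ (range expInner), ∫ ξ, g ξ * h ξ ∂surface = 0 := by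
    intro g hg
    induction hg using Submodule.span_induction with
    | mem x hx => obtain ⟨a, rfl⟩ := hx; exact h0 a
    | zero => simp
    | add x y _ _ hx hy =>
      simp only [ContinuousMap.add_apply, add_mul]
      rw [integral_add (hi x) (hi y), hx, hy, add_zero]
    | smul c x _ hx =>
      simp only [ContinuousMap.smul_apply, smul_eq_mul, mul_assoc]
      rw [integral_const_mul, hx, mul_zero]
  have hsep : (Algebra.adjoin ℝ (range expInner)).SeparatesPoints := by
    intro ξ η hne
    refine ⟨expInner ((ξ : E3) - η), mem_image_of_mem _
      (Algebra.subset_adjoin (mem_range_self ((ξ : E3) - η))), fun h => hne ?_⟩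
    have h1 : ⟪(ξ : E3) - η, (ξ : E3)⟫_ℝ = ⟪(ξ : E3) - η, (η : E3)⟫_ℝ := by
      simpa [expInner] using h
    rw [← sub_eq_zero, ← inner_sub_right, inner_self_eq_zero, sub_eq_zero] at h1
    exact Subtype.ext h1
  obtain ⟨M, hM⟩ := isCompact_univ.exists_bound_of_continuousOn hc.continuousOn
  refine (hc.ae_eq_iff_eq surface continuous_zero).1 ?_
  refine ae_eq_zero_of_orthogonal_approx (M := M) hc.aestronglyMeasurable
    (ae_of_all _ fun ξ => hM ξ (mem_univ _)) fun ε hε => ?_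
  set hC : C(Sph, ℝ) := ⟨h, hc⟩
  obtain ⟨⟨g, hg⟩, hgh⟩ := ContinuousMap.exists_mem_subalgebra_near_continuousMap_of_separatesPoints
    _ hsep hC ε hε
  rw [← Subalgebra.mem_toSubmodule, Algebra.adjoin_eq_span, closure_range_expInner] at hg
  refine ⟨g, g.continuous.aestronglyMeasurable, ae_of_all _ fun ξ => ?_, hspan g hg⟩
  exact (ContinuousMap.norm_coe_le_norm (g - hC) ξ).trans hgh.le

/-- For `a = b n` the function `exp ⟪a, ξ⟫` depends on `⟪n, ξ⟫` only, hence is a uniform limit of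
zonal polynomials about `n`. -/
lemma eq_zero_of_forall_zonal {h : Sph → ℝ} (hc : Continuous h)
    (h0 : ∀ (n : E3), ‖n‖ = 1 → ∀ l : ℕ,
      ∫ ξ : Sph, (legendre l).eval ⟪n, (ξ : E3)⟫_ℝ * h ξ ∂surface = 0) : h = 0 := by
  have hpoly : ∀ n : E3, ‖n‖ = 1 → ∀ q : ℝ[X],
      ∫ ξ : Sph, q.eval ⟪n, (ξ : E3)⟫_ℝ * h ξ ∂surface = 0 := by
    intro n hn
    have hi : ∀ q : ℝ[X], Integrable (fun ξ : Sph => q.eval ⟪n, (ξ : E3)⟫_ℝ * h ξ) surface :=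
      fun q => integrable_sph ((q.continuous.comp (by fun_prop)).mul hc)
    refine forall_polynomial_of_legendre (by simp) (fun q r hq hr => ?_) (fun c q hq => ?_)
      (h0 n hn)
    · simp only [eval_add, add_mul]
      rw [integral_add (hi q) (hi r), hq, hr, add_zero]
    · simp only [eval_smul, smul_eq_mul, mul_assoc]
      rw [integral_const_mul, hq, mul_zero]
  refine eq_zero_of_forall_expInner hc fun a => ?_
  obtain ⟨n, hn, b, rfl⟩ : ∃ n : E3, ‖n‖ = 1 ∧ ∃ b : ℝ, a = b • n := by
    by_cases ha : a = 0
    · obtain ⟨n, hn⟩ := exists_unit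
      exact ⟨n, hn, 0, by simp [ha]⟩
    · exact ⟨(‖a‖)⁻¹ • a, norm_smul_inv_norm ha, ‖a‖, by simp [smul_smul, ha]⟩
  rw [← abs_eq_zero]
  refine le_antisymm (le_of_forall_pos_le_add fun ε hε => ?_) (abs_nonneg _)
  rw [zero_add]
  set J := ∫ ξ, |h ξ| ∂surface
  have hJ : 0 ≤ J := integral_nonneg fun ξ => abs_nonneg _
  obtain ⟨q, hq⟩ := exists_polynomial_near_of_continuousOn (-1) 1 (fun s => Real.exp (b * s))
    (by fun_prop) (ε / (J + 1)) (by positivity)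
  have hqi : Integrable (fun ξ : Sph => q.eval ⟪n, (ξ : E3)⟫_ℝ * h ξ) surface :=
    integrable_sph ((q.continuous.comp (by fun_prop)).mul hc)
  have hei : Integrable (fun ξ : Sph => expInner (b • n) ξ * h ξ) surface :=
    integrable_sph ((expInner (b • n)).continuous.mul hc)
  rw [← sub_zero (∫ ξ, expInner (b • n) ξ * h ξ ∂surface), ← hpoly n hn q,
    ← integral_sub hei hqi]
  have h1 : |∫ ξ, (expInner (b • n) ξ * h ξ - q.eval ⟪n, (ξ : E3)⟫_ℝ * h ξ) ∂surface|
      ≤ ∫ ξ, ε / (J + 1) * |h ξ| ∂surface := by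
    rw [← Real.norm_eq_abs]
    refine norm_integral_le_of_norm_le ((integrable_sph hc.abs).const_mul _)
      (ae_of_all _ fun ξ => ?_)
    have h2 := (hq _ (inner_sph_mem hn ξ)).le
    rw [abs_sub_comm] at h2
    rw [← sub_mul, Real.norm_eq_abs, abs_mul]
    refine mul_le_mul_of_nonneg_right ?_ (abs_nonneg _)
    simpa [expInner, real_inner_smul_left] using h2
  refine h1.trans ?_
  rw [integral_const_mul]
  calc ε / (J + 1) * J ≤ ε / (J + 1) * (J + 1) := by gcongr; linarith
    _ = ε := by field_simp

/-- Two reflections: the first takes `a` to `a'`, the second takes the image of `b` to `b'`. The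
second fixes `a'` because equality of the inner products makes `a'` orthogonal to `ρ₁ b - b'`. -/
lemma exists_isometry {a b a' b' : E3} (ha : ‖a‖ = ‖a'‖) (hb : ‖b‖ = ‖b'‖)
    (hab : ⟪a, b⟫_ℝ = ⟪a', b'⟫_ℝ) : ∃ ρ : E3 ≃ₗᵢ[ℝ] E3, ρ a = a' ∧ ρ b = b' := by
  set ρ₁ := (Submodule.span ℝ {a - a'})ᗮ.reflection
  have h1 : ρ₁ a = a' := Submodule.reflection_sub ha
  set ρ₂ := (Submodule.span ℝ {ρ₁ b - b'})ᗮ.reflection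
  have h2 : ρ₂ (ρ₁ b) = b' := Submodule.reflection_sub (by rw [ρ₁.norm_map, hb])
  have h3 : ρ₂ a' = a' := by
    refine Submodule.reflection_mem_subspace_eq_self ?_
    rw [Submodule.mem_orthogonal_singleton_iff_inner_right, inner_sub_left, ← h1,
      ρ₁.inner_map_map, h1, real_inner_comm, hab, real_inner_comm, sub_self]
  exact ⟨ρ₁.trans ρ₂, by simp [h1, h3], by simp [h2]⟩

end Rotation

/-! ### Rotation invariance of the kernel and the partial-wave expansion -/

section Kernel

variable {V : ℝ → ℝ} {c : ℝ} {K : ℝ → E3 → E3 → ℝ} {Kl : ℕ → ℝ → ℝ → ℝ → ℝ}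

lemma continuous_kernel_sph (hK : IsHeatKernel volume punctured (fullOp V) K) {t : ℝ} (ht : 0 < t)
    {x : E3} (hx : x ≠ 0) {r : ℝ} (hr : 0 < r) :
    Continuous fun ξ : Sph => K t x (r • (ξ : E3)) := by
  refine (hK.continuousOn_apply ht (show x ∈ punctured from hx)).comp_continuous (by fun_prop)
    fun ξ => ?_
  have h : r • (ξ : E3) ≠ 0 := smul_ne_zero hr.ne' (norm_ne_zero_iff.1 (by simp))
  exact h

/-- By `angular_kernel`, for every `n` and `l` the functions `K t (ρ x) (ρ ·)` and `K t x` on the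
sphere of radius `‖y‖` have the same zonal moment, namely `P_l(⟪n, x⟫/‖x‖) K_l(t; ‖x‖, ‖y‖)`. -/
lemma kernel_isometry
    (hV : ∀ a b : ℝ, 0 < a → a < b → MemLp V 2 (volume.restrict (Icc a b)))
    (hc : IsSemiboundedExpr volume punctured (fullOp V) c)
    (hK : IsHeatKernel volume punctured (fullOp V) K)
    (hKl : ∀ l, IsHeatKernel radialMeasure halfLine (radialOp V l) (Kl l))
    {t : ℝ} (ht : 0 < t) {x y : E3} (hx : x ≠ 0) (hy : y ≠ 0) (ρ : E3 ≃ₗᵢ[ℝ] E3) :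
    K t (ρ x) (ρ y) = K t x y := by
  have hr : 0 < ‖y‖ := norm_pos_iff.2 hy
  have hρx : ρ x ≠ 0 := by simpa using hx
  have hc1 := continuous_kernel_sph hK ht hρx hr
  have hc2 := continuous_kernel_sph hK ht hx hr
  have hρ : Continuous (sphMap ρ) :=
    Continuous.subtype_mk (ρ.continuous.comp continuous_subtype_val) _
  have hd : Continuous fun ξ : Sph =>
      K t (ρ x) (‖y‖ • (sphMap ρ ξ : E3)) - K t x (‖y‖ • (ξ : E3)) := (hc1.comp hρ).sub hc2
  have h := eq_zero_of_forall_zonal hd fun n hn l => ?_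
  · have h2 := congrFun h ⟨‖y‖⁻¹ • y, by simpa using norm_smul_inv_norm (𝕜 := ℝ) hy⟩
    simp only [sphMap, Pi.zero_apply] at h2
    rw [← map_smul, smul_smul, mul_inv_cancel₀ hr.ne', one_smul] at h2
    exact sub_eq_zero.1 h2
  · have hz := continuous_zonal n l
    have e2 : ∫ ξ : Sph, (legendre l).eval ⟪n, ξ⟫_ℝ * K t x (‖y‖ • (ξ : E3)) ∂surface
        = (legendre l).eval (⟪n, x⟫_ℝ / ‖x‖) * Kl l t ‖x‖ ‖y‖ :=
      angular_kernel hV hc hK (hKl l) hn ht hx hr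
    have e1 : ∫ ξ : Sph, (legendre l).eval ⟪n, ξ⟫_ℝ
          * K t (ρ x) (‖y‖ • (sphMap ρ ξ : E3)) ∂surface
        = (legendre l).eval (⟪n, x⟫_ℝ / ‖x‖) * Kl l t ‖x‖ ‖y‖ := by
      have h1 := angular_kernel hV hc hK (hKl l) (n := ρ n) (by simpa using hn) ht hρx hr
      have h2 : Continuous fun ξ : Sph =>
          (legendre l).eval ⟪ρ n, ξ⟫_ℝ * K t (ρ x) (‖y‖ • (ξ : E3)) :=
        (continuous_zonal (ρ n) l).mul hc1
      rw [ρ.norm_map, ρ.inner_map_map, angular, ← integral_sphMap ρ h2] at h1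
      rw [← h1]
      congr 1 with ξ
      rw [show ⟪ρ n, (sphMap ρ ξ : E3)⟫_ℝ = ⟪n, (ξ : E3)⟫_ℝ from ρ.inner_map_map n ξ]
    have i1 : Integrable (fun ξ : Sph => (legendre l).eval ⟪n, ξ⟫_ℝ
        * K t (ρ x) (‖y‖ • (sphMap ρ ξ : E3))) surface := integrable_sph (hz.mul (hc1.comp hρ))
    have i2 : Integrable (fun ξ : Sph => (legendre l).eval ⟪n, ξ⟫_ℝ
        * K t x (‖y‖ • (ξ : E3))) surface := integrable_sph (hz.mul hc2)
    simp only [mul_sub]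
    rw [integral_sub i1 i2, e1, e2, sub_self]

/-- The unit vector along the polar axis. -/
def pole : E3 := !₂[0, 0, 1]

/-- The unit vector in the first and third coordinates whose third coordinate is `s`. -/
def meridian (s : ℝ) : E3 := !₂[√(1 - s ^ 2), 0, s]

lemma norm_pole : ‖pole‖ = 1 := by simp [pole, EuclideanSpace.norm_eq, Fin.sum_univ_three]

lemma norm_meridian {s : ℝ} (hs : s ∈ Icc (-1 : ℝ) 1) : ‖meridian s‖ = 1 := by
  have h : 0 ≤ 1 - s ^ 2 := by nlinarith [hs.1, hs.2]
  simp [meridian, EuclideanSpace.norm_eq, Fin.sum_univ_three, Real.sq_sqrt h]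

lemma inner_pole_meridian (s : ℝ) : ⟪pole, meridian s⟫_ℝ = s := by
  simp [pole, meridian, PiLp.inner_apply, Fin.sum_univ_three]

lemma continuous_meridian : Continuous meridian := by
  unfold meridian
  refine (PiLp.continuous_toLp 2 _).comp (continuous_pi fun i => ?_)
  fin_cases i <;> simp <;> fun_prop

lemma sph_eq_smul (r θ φ : ℝ) : sph r θ φ = r • sph 1 θ φ := by
  ext i
  fin_cases i <;> simp [sph]

lemma norm_sph_one (θ φ : ℝ) : ‖sph 1 θ φ‖ = 1 := by
  have h : (Real.sin θ * Real.cos φ) ^ 2 + (Real.sin θ * Real.sin φ) ^ 2 + Real.cos θ ^ 2 = 1 := by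
    have h1 := Real.sin_sq_add_cos_sq θ
    have h2 := Real.sin_sq_add_cos_sq φ
    linear_combination h1 + Real.sin θ ^ 2 * h2
  simp [sph, EuclideanSpace.norm_eq, Fin.sum_univ_three, h]

lemma inner_sph_one (θ φ θ' φ' : ℝ) :
    ⟪sph 1 θ φ, sph 1 θ' φ'⟫_ℝ = cosAngle θ φ θ' φ' := by
  simp [sph, cosAngle, PiLp.inner_apply, Fin.sum_univ_three, Real.cos_sub]
  ring

lemma cosAngle_mem (θ φ θ' φ' : ℝ) : cosAngle θ φ θ' φ' ∈ Icc (-1 : ℝ) 1 := by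
  have h := abs_real_inner_le_norm (sph 1 θ φ) (sph 1 θ' φ')
  rw [norm_sph_one, norm_sph_one, one_mul, inner_sph_one] at h
  exact abs_le.1 h

/-- The kernel as a function of the radii and of the cosine of the angle. -/
def zonalKernel (K : ℝ → E3 → E3 → ℝ) (t r r' s : ℝ) : ℝ :=
  K t (r • pole) (r' • meridian s)

lemma kernel_eq_zonalKernel
    (hV : ∀ a b : ℝ, 0 < a → a < b → MemLp V 2 (volume.restrict (Icc a b)))
    (hc : IsSemiboundedExpr volume punctured (fullOp V) c)
    (hK : IsHeatKernel volume punctured (fullOp V) K)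
    (hKl : ∀ l, IsHeatKernel radialMeasure halfLine (radialOp V l) (Kl l))
    {t r r' : ℝ} (ht : 0 < t) (hr : 0 < r) (hr' : 0 < r') {a b : E3} (ha : ‖a‖ = 1)
    (hb : ‖b‖ = 1) : K t (r • a) (r' • b) = zonalKernel K t r r' ⟪a, b⟫_ℝ := by
  have hs : ⟪a, b⟫_ℝ ∈ Icc (-1 : ℝ) 1 := inner_sph_mem ha ⟨b, by simpa using hb⟩
  obtain ⟨ρ, h1, h2⟩ := exists_isometry (a := a) (b := b) (a' := pole)
    (b' := meridian ⟪a, b⟫_ℝ) (by rw [ha, norm_pole]) (by rw [hb, norm_meridian hs])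
    (inner_pole_meridian _).symm
  have hne : ∀ {a : E3} {r : ℝ}, ‖a‖ = 1 → 0 < r → r • a ≠ 0 := fun ha hr =>
    smul_ne_zero hr.ne' (norm_ne_zero_iff.1 (by simp [ha]))
  rw [zonalKernel, ← h1, ← h2, ← map_smul, ← map_smul,
    kernel_isometry hV hc hK hKl ht (hne ha hr) (hne hb hr')]

lemma continuousOn_zonalKernel (hK : IsHeatKernel volume punctured (fullOp V) K)
    {t r r' : ℝ} (ht : 0 < t) (hr : 0 < r) (hr' : 0 < r') :
    ContinuousOn (zonalKernel K t r r') (Icc (-1) 1) := by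
  have hne : ∀ {a : E3} {r : ℝ}, ‖a‖ = 1 → 0 < r → r • a ≠ 0 := fun ha hr =>
    smul_ne_zero hr.ne' (norm_ne_zero_iff.1 (by simp [ha]))
  exact (hK.continuousOn_apply ht (show r • pole ∈ punctured from hne norm_pole hr)).comp
    (continuous_meridian.const_smul r').continuousOn fun s hs => hne (norm_meridian hs) hr'

/-- With `n` and `x` both along the pole, the factor in `angular_kernel` is `P_l(1) = 1`, and the
hat-box theorem evaluates the surface integral. -/
lemma radialKernel_eq
    (hV : ∀ a b : ℝ, 0 < a → a < b → MemLp V 2 (volume.restrict (Icc a b)))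
    (hc : IsSemiboundedExpr volume punctured (fullOp V) c)
    (hK : IsHeatKernel volume punctured (fullOp V) K)
    (hKl : ∀ l, IsHeatKernel radialMeasure halfLine (radialOp V l) (Kl l))
    {t r r' : ℝ} (ht : 0 < t) (hr : 0 < r) (hr' : 0 < r') (l : ℕ) :
    Kl l t r r' = 2 * Real.pi * legendreCoeff (zonalKernel K t r r') l := by
  have hne : r • pole ≠ 0 := smul_ne_zero hr.ne' (norm_ne_zero_iff.1 (by simp [norm_pole]))
  have h := angular_kernel hV hc hK (hKl l) norm_pole ht hne hr'
  have hnorm : ‖r • pole‖ = r := by rw [norm_smul, norm_pole, mul_one, Real.norm_of_nonneg hr.le]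
  rw [hnorm, inner_smul_right, real_inner_self_eq_norm_sq, norm_pole, one_pow, mul_one,
    div_self hr.ne', legendre_eval_one, one_mul] at h
  have hcont : ContinuousOn (fun s => (legendre l).eval s * zonalKernel K t r r' s) (Icc (-1) 1) :=
    (legendre l).continuous.continuousOn.mul (continuousOn_zonalKernel hK ht hr hr')
  rw [← h, legendreCoeff, ← integral_zonal norm_pole hcont, angular]
  congr 1 with ξ
  rw [kernel_eq_zonalKernel hV hc hK hKl ht hr hr' norm_pole (norm_sph_coe ξ)]

/-- Equal radii give nonnegative coefficients, hence summability; the Gram inequality dominates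
unequal radii by the two diagonal series. -/
lemma summable_zonalKernel
    (hV : ∀ a b : ℝ, 0 < a → a < b → MemLp V 2 (volume.restrict (Icc a b)))
    (hc : ∀ ψ : 𝓓(punctured, ℝ), -c * ∫ x, ψ x ^ 2 ≤ ∫ x, ψ x * fullOp V ψ x)
    (hK : IsHeatKernel volume punctured (fullOp V) K)
    (hKl : ∀ l, IsHeatKernel radialMeasure halfLine (radialOp V l) (Kl l))
    {t r r' : ℝ} (ht : 0 < t) (hr : 0 < r) (hr' : 0 < r') :
    Summable fun l : ℕ => (2 * (l : ℝ) + 1) * |legendreCoeff (zonalKernel K t r r') l| := by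
  have hc' := isSemiboundedExpr_fullOp hc
  have hbound := fun (l : ℕ) {a b : ℝ} (ha : 0 < a) (hb : 0 < b) =>
    (hKl l).diag_bounds (fun U h1 h2 h3 => radialMeasure_pos h1 h2 h3)
      (isSemiboundedExpr_radialOp hV hc l) ht (show a ∈ halfLine from ha)
      (show b ∈ halfLine from hb)
  have heq := fun (l : ℕ) {a b : ℝ} (ha : 0 < a) (hb : 0 < b) =>
    radialKernel_eq hV hc' hK hKl ht ha hb l
  have h2π : 0 < 2 * Real.pi := by positivity
  have hdiag : ∀ {a : ℝ}, 0 < a →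
      Summable fun l : ℕ => (2 * (l : ℝ) + 1) * legendreCoeff (zonalKernel K t a a) l := by
    intro a ha
    refine summable_legendreCoeff_of_nonneg (continuousOn_zonalKernel hK ht ha ha) fun l => ?_
    have h := (hbound l ha ha).1
    rw [heq l ha ha] at h
    exact nonneg_of_mul_nonneg_right h h2π
  refine Summable.of_nonneg_of_le (fun l => by positivity) (fun l => ?_)
    ((hdiag hr).add (hdiag hr'))
  have h := (hbound l hr hr').2
  rw [heq l hr hr', heq l hr hr, heq l hr' hr', abs_mul, abs_of_pos h2π] at h
  rw [← mul_add]
  gcongr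
  have h3 : 2 * Real.pi * (2 * |legendreCoeff (zonalKernel K t r r') l|) ≤
      2 * Real.pi * (legendreCoeff (zonalKernel K t r r) l
        + legendreCoeff (zonalKernel K t r' r') l) := by linarith
  have h4 := le_of_mul_le_mul_left h3 h2π
  linarith [abs_nonneg (legendreCoeff (zonalKernel K t r r') l)]

end Kernel

end PartialWave

end

/-- In `ℝ`, `HasSum` is unconditional and therefore absolute convergence. The integrability clause
excludes the default value `0` of the integral. -/
theorem lemma1 (V : ℝ → ℝ)
    (hV : ∀ a b : ℝ, 0 < a → a < b → MemLp V 2 (volume.restrict (Icc a b)))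
    (hbdd : ∃ c : ℝ, ∀ ψ : 𝓓(PartialWave.punctured, ℝ),
      -c * ∫ x, ψ x ^ 2 ≤ ∫ x, ψ x * PartialWave.fullOp V ψ x)
    (K : ℝ → PartialWave.E3 → PartialWave.E3 → ℝ)
    (hK : PartialWave.IsHeatKernel volume PartialWave.punctured (PartialWave.fullOp V) K)
    (Kl : ℕ → ℝ → ℝ → ℝ → ℝ)
    (hKl : ∀ l : ℕ, PartialWave.IsHeatKernel PartialWave.radialMeasure PartialWave.halfLine
      (PartialWave.radialOp V l) (Kl l)) :
    ∃ k : ℝ → ℝ → ℝ → ℝ → ℝ,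
      (∀ t r r' : ℝ, 0 < t → 0 < r → 0 < r' → ∀ θ φ θ' φ' : ℝ,
        K t (PartialWave.sph r θ φ) (PartialWave.sph r' θ' φ') =
          k t r r' (PartialWave.cosAngle θ φ θ' φ')) ∧
      (∀ (l : ℕ) (t r r' : ℝ), 0 < t → 0 < r → 0 < r' →
        IntervalIntegrable (fun s => (PartialWave.legendre l).eval s * k t r r' s)
          volume (-1) 1 ∧
        Kl l t r r' =
          2 * Real.pi * ∫ s in (-1 : ℝ)..1, (PartialWave.legendre l).eval s * k t r r' s) ∧
      (∀ t r r' : ℝ, 0 < t → 0 < r → 0 < r' → ∀ θ φ θ' φ' : ℝ,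
        HasSum
          (fun l : ℕ => 1 / (4 * Real.pi) * ((2 * (l : ℝ) + 1) *
            (PartialWave.legendre l).eval (PartialWave.cosAngle θ φ θ' φ') * Kl l t r r'))
          (K t (PartialWave.sph r θ φ) (PartialWave.sph r' θ' φ'))) := by
  obtain ⟨c, hc⟩ := hbdd
  have hc' := PartialWave.isSemiboundedExpr_fullOp hc
  refine ⟨PartialWave.zonalKernel K, ?_, ?_, ?_⟩
  · intro t r r' ht hr hr' θ φ θ' φ'
    rw [PartialWave.sph_eq_smul r, PartialWave.sph_eq_smul r',
      PartialWave.kernel_eq_zonalKernel hV hc' hK hKl ht hr hr' (PartialWave.norm_sph_one _ _)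
        (PartialWave.norm_sph_one _ _), PartialWave.inner_sph_one]
  · intro l t r r' ht hr hr'
    exact ⟨PartialWave.intervalIntegrable_eval_mul
      (PartialWave.continuousOn_zonalKernel hK ht hr hr') _,
      PartialWave.radialKernel_eq hV hc' hK hKl ht hr hr' l⟩
  · intro t r r' ht hr hr' θ φ θ' φ'
    have h := PartialWave.hasSum_legendre (PartialWave.continuousOn_zonalKernel hK ht hr hr')
      (PartialWave.summable_zonalKernel hV hc hK hKl ht hr hr')
      (PartialWave.cosAngle_mem θ φ θ' φ')
    rw [PartialWave.sph_eq_smul r, PartialWave.sph_eq_smul r',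
      PartialWave.kernel_eq_zonalKernel hV hc' hK hKl ht hr hr' (PartialWave.norm_sph_one _ _)
        (PartialWave.norm_sph_one _ _), PartialWave.inner_sph_one]
    refine h.congr_fun fun l => ?_
    rw [PartialWave.radialKernel_eq hV hc' hK hKl ht hr hr' l]
    have hπ := Real.pi_ne_zero
    field_simp
    ring
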